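/- **Setting.** Let $F$ be an imaginary quadratic field with a fixed embedding $F\subset\mathbb C$, let $K/F$ be an extension of degree $n$, and let $\rho_1,\dots,\rho_n$ be the embeddings $K\to\mathbb C$ fixing $F$. Let $\mathfrak f,\mathfrak b$ be nonzero relatively prime integral ideals of $K$ and $r\in\mathfrak b^{-1}$. Let $m_1,\dots,m_n$ be a basis of $K/F$ and $\Lambda_1,\dots,\Lambda_n$ fractional ideals of $\mathcal O_F$ with $\mathfrak f\mathfrak b^{-1}=\Lambda_1m_1+\cdots+\Lambda_nm_n$. Write $r=u_1m_1+\cdots+u_nm_n$ with $u_i\in F$, and put $\mathbf u=(u_1,\dots,u_n)$, $\mathbf\Lambda=\Lambda_1\times\cdots\times\Lambda_n$. Let $M\in GL_n(\mathbb C)$ be the matrix with entries $M_{ij}=\rho_j(m_i)$, let $P(X)=\prod_{i=1}^n X M_i^{-T}$, where $M_i^{-T}$ is the $i$-th column of $M^{-T}$, and for $\eta\in\mathcal O_K^\times$ let $\varrho(\eta)=M\,\mathrm{diag}(\rho_1(\eta),\dots,\rho_n(\eta))\,M^{-1}$. **The cocycle.** For an $n\times n$ matrix $\sigma$ with columns $\sigma_j$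 and a row vector $x$ put $f(\sigma)(x)=\det(\sigma)/\prod_j\langle x,\sigma_j\rangle$ and, for a polynomial $H$, $f(\sigma)(H,x)=H(-\partial_{x_1},\dots,-\partial_{x_n})f(\sigma)(x)$ (with value $0$ if some $\langle x,\sigma_j\rangle=0$). For $A_1,\dots,A_n\in GL_n(\mathbb C)$ and $x\neq0$ let $\psi(A_1,\dots,A_n)(H,x)=f(A_{1j_1},\dots,A_{nj_n})(H,x)$, where $A_{kj}$ is the $j$-th column of $A_k$ and $j_k$ is the smallest index with $\langle x,A_{kj_k}\rangle\ne0$; put $\psi(A_1,\dots,A_n)(H,0)=0$. Extend $\psi$ additively to formal integral combinations of $n$-tuples, on which $A\in GL_n(\mathbb C)$ acts by $A(A_1,\dots,A_n)=(AA_1,\dots,AA_n)$. **The cycles.** Let $U^{(1)}_{\mathfrak f}$ be the group of units $\epsilon\in\mathcal O_K^\times$ with $\epsilon\equiv1\pmod{\mathfrak f}$ and $N_{K/F}(\epsilon)=1$, and let $V_{\mathfrak f}$ be a free part of it, i.e. a subgroup such that $U^{(1)}_{\mathfrak f}$ is the direct product of $V_{\mathfrak f}$ and the torsion subgroup of $U^{(1)}_{\mathfrak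 f}$. For a subgroup $V\subseteq V_{\mathfrak f}$ of finite index with generators $\epsilon_1,\dots,\epsilon_{n-1}$ put $$\mathcal E[\mathfrak b,M,V]=(-1)^{n-1}\,\mathrm{sign}(R)\sum_{\pi}\mathrm{sign}(\pi)\,[\varrho(\epsilon_{\pi(1)})|\cdots|\varrho(\epsilon_{\pi(n-1)})],$$ where $[A_1|\cdots|A_{n-1}]=(1,A_1,A_1A_2,\dots,A_1A_2\cdots A_{n-1})$, $\pi$ runs over the permutations of $\{1,\dots,n-1\}$, and $R=\det(2\log|\rho_i(\epsilon_j)|)_{1\le i,j\le n-1}$ is computed from the same generators $\epsilon_1,\dots,\epsilon_{n-1}$. Put $\mathcal E[\mathfrak b,M]=\mathcal E[\mathfrak b,M,V_{\mathfrak f}]$. **Lemma.** Let $l$ be a positive integer and $x\in\mathbf\Lambda+\mathbf u$. 1. The infinite sum $$\sum_{A\in\varrho(V_{\mathfrak f})}\psi\big(A\,\mathcal E[\mathfrak b,M]\big)(P^{l-1},x)$$ converges absolutely, and its value does not depend on the choice of the generators $\epsilon_1,\dots,\epsilon_{n-1}$ of $V_{\mathfrak f}$ used to define $\mathcal E[\mathfrak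 b,M]$. 2. If $V$ is a subgroup of finite index in $V_{\mathfrak f}$, then for every choice of $n-1$ generators of $V_{\mathfrak f}$ and of $V$ both of the following sums converge absolutely and $$\sum_{A\in\varrho(V_{\mathfrak f})}\psi\big(A\,\mathcal E[\mathfrak b,M]\big)(P^{l-1},x)=\sum_{A\in\varrho(V)}\psi\big(A\,\mathcal E[\mathfrak b,M,V]\big)(P^{l-1},x).$$ -/

import Mathlib

open scoped nonZeroDivisors NumberField

noncomputable section

namespace EisensteinCocycle

/-! ### The rational cocycle -/

section RationalCocycle

variable {n : ℕ}

/-- The rational function `det σ / ∏ j ⟨x, σ_j⟩` of a row vector `x`, where `σ_j` is the `j`-th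
column of `σ` (`x ᵥ* σ` is the row vector `(⟨x, σ_j⟩)_j`). -/
def ratFun (σ : Matrix (Fin n) (Fin n) ℂ) (x : Fin n → ℂ) : ℂ :=
  σ.det / ∏ j, (Matrix.vecMul x σ) j

/-- The operator `-∂/∂x_i` on functions on `ℂⁿ`. -/
def negPartial (i : Fin n) (g : (Fin n → ℂ) → ℂ) : (Fin n → ℂ) → ℂ :=
  fun x => -lineDeriv ℂ g x (Pi.single i 1)

/-- The operator `(-∂/∂x_1)^{s_1} ⋯ (-∂/∂x_n)^{s_n}`. -/
def negPartialMonomial (s : Fin n →₀ ℕ) (g : (Fin n → ℂ) → ℂ) : (Fin n → ℂ) → ℂ :=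
  (List.finRange n).foldr (fun i h => (negPartial i)^[s i] h) g

/-- `P(-∂/∂x_1, …, -∂/∂x_n) g`, evaluated at `x`. -/
def polyDiff (P : MvPolynomial (Fin n) ℂ) (g : (Fin n → ℂ) → ℂ) (x : Fin n → ℂ) : ℂ :=
  ∑ s ∈ P.support, P.coeff s * negPartialMonomial s g x

open scoped Classical in
/-- `f(σ)(P, x) = P(-∂) f(σ)(x)`, set to be `0` on the hyperplanes `⟨x, σ_j⟩ = 0`. -/
def ratFunDiff (σ : Matrix (Fin n) (Fin n) ℂ) (P : MvPolynomial (Fin n) ℂ) (x : Fin n → ℂ) : ℂ :=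
  if ∃ j, (Matrix.vecMul x σ) j = 0 then 0 else polyDiff P (ratFun σ) x

open scoped Classical in
theorem nonzero_columns_nonempty (A : GL (Fin n) ℂ) {x : Fin n → ℂ} (hx : x ≠ 0) :
    (Finset.univ.filter fun j => (Matrix.vecMul x A.val) j ≠ 0).Nonempty := by
  by_contra h
  rw [Finset.not_nonempty_iff_eq_empty, Finset.filter_eq_empty_iff] at h
  apply hx
  have h0 : Matrix.vecMul x A.val = 0 := by
    funext j
    simpa using h (Finset.mem_univ j)
  have h1 : Matrix.vecMul (Matrix.vecMul x A.val) (A⁻¹).val = x := by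
    rw [Matrix.vecMul_vecMul, ← Units.val_mul, mul_inv_cancel, Units.val_one, Matrix.vecMul_one]
  rw [← h1, h0, Matrix.zero_vecMul]

open scoped Classical in
/-- The smallest index `j` such that `⟨x, A_j⟩ ≠ 0`, where `A_j` is the `j`-th column of `A`. -/
def firstColumn (A : GL (Fin n) ℂ) {x : Fin n → ℂ} (hx : x ≠ 0) : Fin n :=
  (Finset.univ.filter fun j => (Matrix.vecMul x A.val) j ≠ 0).min' (nonzero_columns_nonempty A hx)

open scoped Classical in
/-- The rational cocycle `ψ(A_1, …, A_n)(P, x) = f(A_{1 j_1}, …, A_{n j_n})(P, x)`, where `j_k` is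
the smallest index such that `⟨x, A_{k j_k}⟩ ≠ 0`; it is `0` at `x = 0`. -/
def psi (𝔄 : Fin n → GL (Fin n) ℂ) (P : MvPolynomial (Fin n) ℂ) (x : Fin n → ℂ) : ℂ :=
  if hx : x = 0 then 0
  else ratFunDiff (Matrix.of fun i k => (𝔄 k).val i (firstColumn (𝔄 k) hx)) P x

/-- Homogeneous `(n-1)`-chains: formal integral combinations of `n`-tuples. -/
abbrev Chain (n : ℕ) : Type := (Fin n → GL (Fin n) ℂ) →₀ ℤ

/-- The diagonal left action `A (A_1, …, A_n) = (A A_1, …, A A_n)`, extended to chains. -/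
def Chain.translate (A : GL (Fin n) ℂ) (c : Chain n) : Chain n :=
  c.mapDomain fun 𝔄 k => A * 𝔄 k

/-- `ψ`, extended additively to chains. -/
def psiChain (c : Chain n) (P : MvPolynomial (Fin n) ℂ) (x : Fin n → ℂ) : ℂ :=
  c.sum fun 𝔄 a => (a : ℂ) * psi 𝔄 P x

/-- `[A_1 | … | A_{n-1}] = (1, A_1, A_1 A_2, …, A_1 A_2 ⋯ A_{n-1})`. -/
def bar (A : Fin (n - 1) → GL (Fin n) ℂ) : Fin n → GL (Fin n) ℂ :=
  fun k => ((List.ofFn A).take k).prod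

end RationalCocycle

/-! ### Groups of units -/

section UnitGroups

variable (F : Type*) {K : Type*} [Field F] [Field K] [Algebra F K]

/-- `U_𝔣`, the group of units congruent to `1` modulo `𝔣`. -/
def unitsCongrOne (𝔣 : Ideal (𝓞 K)) : Subgroup (𝓞 K)ˣ :=
  (Units.map (Ideal.Quotient.mk 𝔣 : 𝓞 K →* 𝓞 K ⧸ 𝔣)).ker

/-- `U_𝔣^{(1)}`, the group of units congruent to `1` modulo `𝔣` and of relative norm `1`. -/
def unitsCongrOneNormOne (𝔣 : Ideal (𝓞 K)) : Subgroup (𝓞 K)ˣ :=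
  unitsCongrOne 𝔣 ⊓
    (Units.map ((Algebra.norm F : K →* F).comp (algebraMap (𝓞 K) K : 𝓞 K →* K))).ker

/-- `V` is a free part of `U_𝔣^{(1)}`: the latter is the internal direct product of `V` and of its
torsion subgroup. -/
structure IsFreePart (𝔣 : Ideal (𝓞 K)) (V : Subgroup (𝓞 K)ˣ) : Prop where
  inf_torsion : V ⊓ CommGroup.torsion (𝓞 K)ˣ = ⊥
  sup_torsion : V ⊔ (unitsCongrOneNormOne F 𝔣 ⊓ CommGroup.torsion (𝓞 K)ˣ) =
    unitsCongrOneNormOne F 𝔣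

end UnitGroups

/-! ### The cycle attached to a basis and a system of generators -/

section Cycle

variable {n : ℕ} {F K : Type*} [Field F] [CharZero F] [Algebra F ℂ] [Field K] [Algebra F K]

/-- The matrix with columns `M_i = (ρ_i(m_1), …, ρ_i(m_n))ᵀ`. -/
def embMatrix (m : Module.Basis (Fin n) F K) (ρ : Fin n ≃ (K →ₐ[F] ℂ)) :
    Matrix (Fin n) (Fin n) ℂ :=
  Matrix.of fun i j => ρ j (m i)

theorem embMatrix_det_ne_zero (m : Module.Basis (Fin n) F K) (ρ : Fin n ≃ (K →ₐ[F] ℂ)) :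
    (embMatrix m ρ).det ≠ 0 := by
  have : Module.Finite F K := Module.Finite.of_basis m
  have h1 := Algebra.discr_eq_det_embeddingsMatrixReindex_pow_two F ℂ (⇑m) ρ
  have h2 := Algebra.discr_not_zero_of_basis F m
  have h3 : Algebra.embeddingsMatrixReindex F ℂ (⇑m) ρ = embMatrix m ρ := by
    ext i j
    simp [Algebra.embeddingsMatrixReindex, embMatrix, Algebra.embeddingsMatrix]
  rw [h3] at h1
  intro h
  rw [h, zero_pow two_ne_zero, map_eq_zero] at h1
  exact h2 h1

/-- `M`, as an element of `GL_n(ℂ)`. -/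
def embGL (m : Module.Basis (Fin n) F K) (ρ : Fin n ≃ (K →ₐ[F] ℂ)) : GL (Fin n) ℂ :=
  Matrix.GeneralLinearGroup.mkOfDetNeZero (embMatrix m ρ) (embMatrix_det_ne_zero m ρ)

/-- `δ(η) = diag(ρ_1(η), …, ρ_n(η))`. -/
def diagUnits (ρ : Fin n ≃ (K →ₐ[F] ℂ)) : (𝓞 K)ˣ →* GL (Fin n) ℂ :=
  Units.map
    { toFun := fun a => Matrix.diagonal fun i => ρ i (algebraMap (𝓞 K) K a)
      map_one' := by simp
      map_mul' := by intro a b; simp [Matrix.diagonal_mul_diagonal] }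

/-- The representation `ϱ(η) = M δ(η) M⁻¹`. -/
def unitRep (m : Module.Basis (Fin n) F K) (ρ : Fin n ≃ (K →ₐ[F] ℂ)) :
    (𝓞 K)ˣ →* GL (Fin n) ℂ :=
  (MulAut.conj (embGL m ρ)).toMonoidHom.comp (diagUnits ρ)

/-- The norm form `P(X) = ∏ i, X · M_i^{-T}`, where `M_i^{-T}` is the `i`-th column of `M^{-T}`. -/
def normForm (m : Module.Basis (Fin n) F K) (ρ : Fin n ≃ (K →ₐ[F] ℂ)) :
    MvPolynomial (Fin n) ℂ :=
  ∏ i, ∑ j, MvPolynomial.X j * MvPolynomial.C ((embGL m ρ)⁻¹.val.transpose j i)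

/-- The regulator `det (2 log |ρ_i(ε_j)|)`, `1 ≤ i, j ≤ n - 1`. -/
def regulator (ρ : Fin n ≃ (K →ₐ[F] ℂ)) (ε : Fin (n - 1) → (𝓞 K)ˣ) : ℝ :=
  (Matrix.of fun i j : Fin (n - 1) =>
    2 * Real.log ‖ρ (Fin.castLE (Nat.sub_le n 1) i) (algebraMap (𝓞 K) K (ε j))‖).det

/-- The chain
`(-1)^{n-1} sign(R) ∑_π sign(π) [ϱ(ε_{π(1)}) | … | ϱ(ε_{π(n-1)})]`,
where `R` is the regulator of `ε_1, …, ε_{n-1}`. -/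
def cycle (m : Module.Basis (Fin n) F K) (ρ : Fin n ≃ (K →ₐ[F] ℂ))
    (ε : Fin (n - 1) → (𝓞 K)ˣ) : Chain n :=
  ((-1) ^ (n - 1) * (SignType.sign (regulator ρ ε) : ℤ)) •
    ∑ π : Equiv.Perm (Fin (n - 1)),
      Finsupp.single (bar fun i => unitRep m ρ (ε (π i))) ((Equiv.Perm.sign π : ℤˣ) : ℤ)

/-- The term `ψ(A 𝓔)(P^{l-1}, x)` of the infinite sum, for the cycle `𝓔` of the system `ε`. -/
def cycleTerm (m : Module.Basis (Fin n) F K) (ρ : Fin n ≃ (K →ₐ[F] ℂ))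
    (ε : Fin (n - 1) → (𝓞 K)ˣ) (l : ℕ) (x : Fin n → F) (A : GL (Fin n) ℂ) : ℂ :=
  psiChain ((cycle m ρ ε).translate A) (normForm m ρ ^ (l - 1)) fun i => algebraMap F ℂ (x i)

end Cycle

end EisensteinCocycle

end

/-! Write `d = n - 1` and let `Φ(t_0, …, t_d)` be the value of `ψ` at `x` on the matrices `ϱ(t_k)`,
for `t_k` in the free part `V`. The determinant identity behind `ψ` makes `Φ` a homogeneous cocycle
(`isHomogeneousCocycle_psi`). Summing its translates over a subgroup `H` gives an `H`-invariant
cocycle `orbitSum H Φ`, and the series of the lemma is, up to signs, the sum of this cocycle over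
the simplices of the cube spanned by the generators (`altSum`).

Algebra. For an invariant cocycle `altSum` is alternating and multilinear in the edges
(`altSum_cons_mul`), so passing from generators `w` of `V` to generators `w'` of `H` multiplies it
by the determinant `D` of `w'` in the basis `w`. The orbit sum over `V` also splits over the cosets
of `H`, and `altSum_translate` makes all cosets contribute equally, which produces the factor `[V :
H] = |D|`. What remains is the sign of `D`, exactly the quotient of the signs of the two regulators
(`sign_mul_altSum_orbitSum`). Independence of the generators is the case `H = V`.

Convergence. Norm-one units have determinant one and preserve the norm form, so translating a tuple
by `ϱ(η)` amounts to moving `x` to `x ϱ(η)` (`psi_mul`). The nonzero linear forms occurring there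
are bounded below, because nonzero integers of an imaginary quadratic field have absolute value at
least one; this gives `ψ = O(1 / ‖x ϱ(η)‖)` (`exists_norm_mul_norm_psi_le`). Since `‖x ϱ(η)‖` grows
exponentially in the coordinates of `η` when `x ≠ 0`, the series is dominated by a geometric one. If
the regulator vanishes, the cycle is zero and nothing has to converge, so no nonvanishing theorem
for regulators is needed. -/

noncomputable section

namespace EisensteinCocycle

/-! ### Antisymmetrization of homogeneous cocycles on an abelian group -/

section AltSum

open Equiv.Perm

variable {G : Type*} [CommGroup G] {d : ℕ}

/-- The sign of a permutation as a complex number. -/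
abbrev sgn {k : ℕ} (π : Equiv.Perm (Fin k)) : ℂ := ((Equiv.Perm.sign π : ℤ) : ℂ)

/-- The alternating sum of a homogeneous cochain over the simplices of the cube spanned by `w`. -/
def altSum (c : (Fin (d + 1) → G) → ℂ) (w : Fin d → G) : ℂ :=
  ∑ π : Equiv.Perm (Fin d), sgn π * c (Fin.partialProd (w ∘ π))

/-- The homogeneous cocycle relation. -/
def IsHomogeneousCocycle {X : Type*} (c : (Fin (d + 1) → X) → ℂ) : Prop :=
  ∀ t : Fin (d + 2) → X, ∑ j : Fin (d + 2), (-1 : ℂ) ^ (j : ℕ) * c (t ∘ j.succAbove) = 0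

theorem altSum_comp_perm (c : (Fin (d + 1) → G) → ℂ) (w : Fin d → G) (τ : Equiv.Perm (Fin d)) :
    altSum c (w ∘ τ) = sgn τ * altSum c w := by
  unfold altSum
  rw [Finset.mul_sum, ← Equiv.sum_comp (Equiv.mulLeft τ⁻¹)]
  refine Finset.sum_congr rfl fun π _ => ?_
  simp only [Equiv.coe_mulLeft, sgn, Equiv.Perm.sign_mul, Equiv.Perm.sign_inv, Units.val_mul, Int.cast_mul]
  rw [mul_assoc]
  congr 3
  funext i
  congr 1
  funext j
  simp

theorem altSum_eq_zero_of_eq (c : (Fin (d + 1) → G) → ℂ) (w : Fin d → G) {i j : Fin d}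
    (hij : i ≠ j) (h : w i = w j) : altSum c w = 0 := by
  have h1 := altSum_comp_perm c w (Equiv.swap i j)
  have h2 : w ∘ Equiv.swap i j = w := by
    funext k
    rcases eq_or_ne k i with rfl | hki
    · simp [h]
    rcases eq_or_ne k j with rfl | hkj
    · simp [h]
    simp [Equiv.swap_apply_of_ne_of_ne hki hkj]
  rw [h2] at h1
  simp only [sgn, sign_swap hij, Units.val_neg, Units.val_one, Int.cast_neg, Int.cast_one] at h1
  linear_combination h1 / 2

/-- By commutativity, an inner face forgets the order of the two edges that it merges. -/
theorem contractNth_comp_swap (w : Fin (d + 1) → G) (i : Fin d) :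
    Fin.contractNth i.castSucc (· * ·) (w ∘ Equiv.swap i.castSucc i.succ) =
      Fin.contractNth i.castSucc (· * ·) w := by
  funext k
  rcases lt_trichotomy k i with h | rfl | h
  · have h' : (k : ℕ) < (i.castSucc : ℕ) := h
    rw [Fin.contractNth_apply_of_lt _ _ _ _ h', Fin.contractNth_apply_of_lt _ _ _ _ h',
      Function.comp_apply, Equiv.swap_apply_of_ne_of_ne]
    · exact fun e => h.ne (Fin.castSucc_injective _ e)
    · intro e
      have := congrArg Fin.val e
      simp only [Fin.val_castSucc, Fin.val_succ] at this h'
      omega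
  · rw [Fin.contractNth_apply_of_eq _ _ _ _ rfl, Fin.contractNth_apply_of_eq _ _ _ _ rfl]
    simp [mul_comm]
  · have h' : (i.castSucc : ℕ) < (k : ℕ) := h
    rw [Fin.contractNth_apply_of_gt _ _ _ _ h', Fin.contractNth_apply_of_gt _ _ _ _ h',
      Function.comp_apply, Equiv.swap_apply_of_ne_of_ne]
    · intro e
      have := congrArg Fin.val e
      simp only [Fin.val_castSucc, Fin.val_succ] at this h'
      omega
    · exact fun e => h.ne' (Fin.succ_injective _ e)

/-- The transposition of the merged edges keeps the face and the weight but reverses the sign, so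
the terms cancel in pairs. -/
theorem sum_weight_contractNth_eq_zero (c : (Fin (d + 1) → G) → ℂ) (w : Fin (d + 1) → G)
    (χ : Equiv.Perm (Fin (d + 1)) → ℂ) (i : Fin d)
    (hχ : ∀ σ, χ (σ * Equiv.swap i.castSucc i.succ) = χ σ) :
    ∑ σ, χ σ * (sgn σ * c (Fin.partialProd (Fin.contractNth i.castSucc (· * ·) (w ∘ σ)))) = 0 := by
  set S := ∑ σ, χ σ * (sgn σ *
    c (Fin.partialProd (Fin.contractNth i.castSucc (· * ·) (w ∘ σ)))) with hS
  have h : S = -S := by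
    conv_lhs => rw [hS, ← Equiv.sum_comp (Equiv.mulRight (Equiv.swap i.castSucc i.succ))]
    rw [hS, ← Finset.sum_neg_distrib]
    refine Finset.sum_congr rfl fun σ _ => ?_
    rw [Equiv.coe_mulRight, hχ, coe_mul, ← Function.comp_assoc, contractNth_comp_swap]
    have : sgn (σ * Equiv.swap i.castSucc i.succ) = -sgn σ := by
      simp [sgn, sign_swap Fin.castSucc_lt_succ.ne]
    rw [this]
    ring
  linear_combination h / 2

theorem init_comp_finRotate {α : Type*} (w : Fin (d + 1) → α) (σ : Equiv.Perm (Fin (d + 1))) :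
    (Fin.init (w ∘ (σ * finRotate (d + 1) : Equiv.Perm (Fin (d + 1)))) : Fin d → α) =
      Fin.tail (w ∘ σ) := by
  funext k
  simp [Fin.init, Fin.tail]

/-- The boundary of the cube spanned by `w`, with weights on its simplices. -/
theorem weighted_cube_boundary {c : (Fin (d + 1) → G) → ℂ} (hc : IsHomogeneousCocycle c)
    (w : Fin (d + 1) → G) (χ : Equiv.Perm (Fin (d + 1)) → ℂ) :
    ∑ σ, sgn σ * (χ σ * c (fun k => w (σ 0) * Fin.partialProd (Fin.tail (w ∘ σ)) k) -
        χ (σ * finRotate (d + 1)) * c (Fin.partialProd (Fin.tail (w ∘ σ)))) =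
      ∑ i : Fin d, (-1 : ℂ) ^ (i : ℕ) * ∑ σ, χ σ * (sgn σ *
        c (Fin.partialProd (Fin.contractNth i.castSucc (· * ·) (w ∘ σ)))) := by
  have h0 : ∑ σ, χ σ * sgn σ * ∑ j : Fin (d + 2), (-1 : ℂ) ^ (j : ℕ) *
      c (Fin.partialProd (w ∘ σ) ∘ j.succAbove) = 0 :=
    Finset.sum_eq_zero fun σ _ => by rw [hc (Fin.partialProd (w ∘ σ)), mul_zero]
  have hfirst (σ : Equiv.Perm (Fin (d + 1))) :
      Fin.partialProd (w ∘ σ) ∘ (0 : Fin (d + 2)).succAbove =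
        fun k => w (σ 0) * Fin.partialProd (Fin.tail (w ∘ σ)) k := by
    funext k
    simp only [Function.comp_apply, Fin.zero_succAbove]
    exact Fin.partialProd_succ' (w ∘ σ) k
  have hlast (σ : Equiv.Perm (Fin (d + 1))) :
      Fin.partialProd (Fin.contractNth (Fin.last d) (· * ·) (w ∘ σ)) =
        Fin.partialProd (Fin.init (w ∘ σ)) := by
    rw [Fin.partialProd_contractNth]
    funext k
    rw [Function.comp_apply, Fin.succ_last, Fin.succAbove_last]
    exact (Fin.partialProd_init k).symm
  simp only [Fin.sum_univ_succ (n := d + 1), Fin.sum_univ_castSucc (n := d), hfirst,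
    ← Fin.partialProd_contractNth, hlast, mul_add, Finset.sum_add_distrib] at h0
  -- Rotating the order of the edges turns the last face into a first face. The sign `(-1)^d` of the
  -- rotation against `(-1)^(d+1)` from the boundary leaves `-1`.
  have hrot : ∑ σ, χ σ * sgn σ * ((-1 : ℂ) ^ ((Fin.last d).succ : ℕ) *
        c (Fin.partialProd (Fin.init (w ∘ σ)))) =
      -∑ σ, sgn σ * (χ (σ * finRotate (d + 1)) * c (Fin.partialProd (Fin.tail (w ∘ σ)))) := by
    rw [← Equiv.sum_comp (Equiv.mulRight (finRotate (d + 1))), ← Finset.sum_neg_distrib]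
    refine Finset.sum_congr rfl fun σ _ => ?_
    rw [Equiv.coe_mulRight, init_comp_finRotate]
    have h1 : sgn (σ * finRotate (d + 1)) = sgn σ * (-1) ^ d := by
      simp [sgn, sign_finRotate]
    have h2 : (-1 : ℂ) ^ d * (-1) ^ d = 1 := by rw [← mul_pow]; simp
    rw [h1, Fin.val_succ, Fin.val_last, pow_succ]
    linear_combination (-χ (σ * finRotate (d + 1)) * sgn σ *
      c (Fin.partialProd (Fin.tail (w ∘ σ)))) * h2
  have hmid : ∑ σ, χ σ * sgn σ * ∑ i : Fin d, (-1 : ℂ) ^ (i.castSucc.succ : ℕ) *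
        c (Fin.partialProd (Fin.contractNth i.castSucc (· * ·) (w ∘ σ))) =
      -∑ i : Fin d, (-1 : ℂ) ^ (i : ℕ) * ∑ σ, χ σ * (sgn σ *
        c (Fin.partialProd (Fin.contractNth i.castSucc (· * ·) (w ∘ σ)))) := by
    simp only [Finset.mul_sum]
    rw [Finset.sum_comm, ← Finset.sum_neg_distrib]
    refine Finset.sum_congr rfl fun i _ => ?_
    rw [← Finset.sum_neg_distrib]
    refine Finset.sum_congr rfl fun σ _ => ?_
    rw [Fin.val_succ, Fin.val_castSucc, pow_succ]
    ring
  rw [hrot, hmid] at h0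
  simp only [mul_sub, Finset.sum_sub_distrib]
  have h3 : ∑ σ, χ σ * sgn σ * ((-1 : ℂ) ^ ((0 : Fin (d + 2)) : ℕ) *
      c fun k => w (σ 0) * Fin.partialProd (Fin.tail (w ∘ σ)) k) =
      ∑ σ, sgn σ * (χ σ * c fun k => w (σ 0) * Fin.partialProd (Fin.tail (w ∘ σ)) k) :=
    Finset.sum_congr rfl fun σ _ => by simp only [Fin.val_zero, pow_zero]; ring
  rw [h3] at h0
  linear_combination h0

theorem sum_perm_eq_sum_decompose {k : ℕ} (f : Equiv.Perm (Fin (k + 1)) → ℂ) :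
    ∑ σ, f σ = ∑ p : Fin (k + 1), ∑ π : Equiv.Perm (Fin k), f (decomposeFin.symm (p, π)) := by
  rw [← Equiv.sum_comp decomposeFin.symm, Fintype.sum_prod_type]

theorem tail_comp_decomposeFin_zero {α : Type*} (w : Fin (d + 1) → α) (π : Equiv.Perm (Fin d)) :
    (Fin.tail (w ∘ (decomposeFin.symm (0, π) : Equiv.Perm (Fin (d + 1)))) : Fin d → α) =
      Fin.tail w ∘ π := by
  funext k
  simp [Fin.tail]

/-- A homotopy argument on the cube spanned by `g` and `w`: inner faces cancel, opposite outer faces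
in a direction `w i` cancel by the invariance `hw`, and the two faces in direction `g` are the two
sides. Invariance under `g` itself is not required. -/
theorem altSum_translate {c : (Fin (d + 1) → G) → ℂ} (hc : IsHomogeneousCocycle c)
    (w : Fin d → G) (hw : ∀ i t, c (fun k => w i * t k) = c t) (g : G) :
    altSum (fun t => c (fun k => g * t k)) w = altSum c w := by
  have h := weighted_cube_boundary hc (Fin.cons g w : Fin (d + 1) → G) (fun _ => 1)
  rw [Finset.sum_eq_zero (f := fun i : Fin d => _) fun i _ => by
    rw [sum_weight_contractNth_eq_zero c _ (fun _ => 1) _ fun _ => rfl, mul_zero]] at h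
  simp only [one_mul] at h
  rw [sum_perm_eq_sum_decompose, Fin.sum_univ_succ, add_comm, Finset.sum_eq_zero, zero_add] at h
  · simp only [decomposeFin_symm_apply_zero, tail_comp_decomposeFin_zero, Fin.tail_cons,
      Fin.cons_zero, decomposeFin.symm_sign, sgn, if_true, one_mul, mul_sub,
      Finset.sum_sub_distrib] at h
    exact sub_eq_zero.1 h
  · intro i _
    refine Finset.sum_eq_zero fun π _ => ?_
    rw [decomposeFin_symm_apply_zero, Fin.cons_succ, hw, sub_self, mul_zero]

/-- The weight of the orderings in which the first edge precedes the second one. -/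
def orderWeight {k : ℕ} (σ : Equiv.Perm (Fin (k + 2))) : ℂ :=
  if σ⁻¹ 0 < σ⁻¹ 1 then 1 else 0

/-- The rotation moves the first edge to the end, which changes the relative order of the edges `0`
and `1` only if one of them comes first. -/
theorem orderWeight_sub_finRotate {k : ℕ} (σ : Equiv.Perm (Fin (k + 2))) :
    orderWeight σ - orderWeight (σ * finRotate (k + 2)) =
      if σ 0 = 0 then 1 else if σ 0 = 1 then -1 else 0 := by
  have hp (p : Fin (k + 2)) : (((finRotate (k + 2))⁻¹ p : Fin (k + 2)) : ℕ) =
      if p = 0 then k + 1 else (p : ℕ) - 1 := by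
    rcases Fin.eq_zero_or_eq_succ p with rfl | ⟨j, rfl⟩
    · rw [if_pos rfl, (Equiv.Perm.inv_eq_iff_eq (f := finRotate (k + 2)) (y := Fin.last _)).2
        finRotate_last.symm, Fin.val_last]
    · rw [if_neg (Fin.succ_ne_zero j), (Equiv.Perm.inv_eq_iff_eq (f := finRotate (k + 2))
        (y := j.castSucc)).2 (by simp)]
      simp
  have hne : σ⁻¹ 0 ≠ σ⁻¹ 1 := fun e => by simpa using (σ⁻¹).injective e
  have e0 : σ 0 = 0 ↔ σ⁻¹ 0 = 0 := by rw [Equiv.Perm.inv_eq_iff_eq, eq_comm]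
  have e1 : σ 0 = 1 ↔ σ⁻¹ 1 = 0 := by rw [Equiv.Perm.inv_eq_iff_eq, eq_comm]
  simp only [orderWeight, mul_inv_rev, Equiv.Perm.mul_apply, e0, e1, Fin.lt_def, hp]
  generalize σ⁻¹ 0 = p at *
  generalize σ⁻¹ 1 = q at *
  simp only [Fin.ext_iff, Fin.val_zero, ne_eq] at *
  split_ifs <;> first | omega | norm_num

/-- The weight is symmetric under the transposition of positions `i` and `i + 1` except on orderings
where `a` and `b` occupy them. Only those with `a` immediately before `b` survive, and the
contraction merges the two into `a * b`. -/
theorem sum_orderWeight_contractNth {k : ℕ} (c : (Fin (k + 2) → G) → ℂ) (a b : G)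
    (w : Fin k → G) (i : Fin (k + 1)) :
    ∑ σ, orderWeight σ * (sgn σ * c (Fin.partialProd (Fin.contractNth i.castSucc (· * ·)
        ((Fin.cons a (Fin.cons b w) : Fin (k + 2) → G) ∘ σ)))) =
      ∑ π : Equiv.Perm (Fin (k + 1)), if π i = 0 then (-1 : ℂ) ^ (i : ℕ) * (sgn π *
        c (Fin.partialProd ((Fin.cons (a * b) w : Fin (k + 1) → G) ∘ π))) else 0 := by
  set W : Fin (k + 2) → G := Fin.cons a (Fin.cons b w) with hW
  set χ : Equiv.Perm (Fin (k + 2)) → ℂ := fun σ =>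
    if σ⁻¹ 0 = i.castSucc ∧ σ⁻¹ 1 = i.succ then 1 else 0 with hχ
  have hswap : ∀ σ : Equiv.Perm (Fin (k + 2)),
      orderWeight (σ * Equiv.swap i.castSucc i.succ) - χ (σ * Equiv.swap i.castSucc i.succ) =
        orderWeight σ - χ σ := by
    intro σ
    have hne : σ⁻¹ 0 ≠ σ⁻¹ 1 := fun e => by simpa using (σ⁻¹).injective e
    simp only [hχ, orderWeight, mul_inv_rev, Equiv.Perm.mul_apply, Equiv.swap_inv]
    generalize σ⁻¹ 0 = p at *
    generalize σ⁻¹ 1 = q at *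
    simp only [Equiv.swap_apply_def, Fin.lt_def, Fin.ext_iff, Fin.val_castSucc, Fin.val_succ,
      ne_eq, apply_ite Fin.val] at *
    split_ifs <;> first | omega | norm_num
  have h1 := sum_weight_contractNth_eq_zero c W (fun σ => orderWeight σ - χ σ) i hswap
  simp only [sub_mul, Finset.sum_sub_distrib] at h1
  -- After this change of variables the component `p` of the decomposition is the edge at position
  -- `i`, and `χ` kills every `p ≠ 0`.
  rw [sub_eq_zero.1 h1, ← Equiv.sum_comp (Equiv.mulRight (Fin.cycleRange i.castSucc)),
    sum_perm_eq_sum_decompose, Fin.sum_univ_succ, add_comm, Finset.sum_eq_zero, zero_add]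
  · refine Finset.sum_congr rfl fun π _ => ?_
    set σ : Equiv.Perm (Fin (k + 2)) := decomposeFin.symm (0, π) * Fin.cycleRange i.castSucc
      with hσ
    have hσ0 : σ i.castSucc = 0 := by simp [hσ]
    have hσs (j : Fin (k + 1)) : σ (i.castSucc.succAbove j) = (π j).succ := by
      rw [hσ, Equiv.Perm.mul_apply, Fin.cycleRange_succAbove, decomposeFin_symm_apply_succ]
      simp
    have hσ1 : σ i.succ = (π i).succ := by
      rw [← hσs, Fin.succAbove_castSucc_self]
    have hχσ : χ σ = if π i = 0 then 1 else 0 := by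
      simp only [hχ, Equiv.Perm.inv_eq_iff_eq, hσ0, hσ1, true_and]
      refine if_congr ?_ rfl rfl
      rw [eq_comm, ← Fin.succ_zero_eq_one, Fin.succ_inj]
    simp only [Equiv.coe_mulRight]
    rw [← hσ, hχσ]
    split_ifs with hπ
    · have hs : sgn σ = (-1) ^ (i : ℕ) * sgn π := by
        simp [hσ, sgn, decomposeFin.symm_sign, Fin.sign_cycleRange, mul_comm]
      have hw : Fin.contractNth i.castSucc (· * ·) (W ∘ σ) =
          (Fin.cons (a * b) w : Fin (k + 1) → G) ∘ π := by
        have hrest (j : Fin (k + 1)) (hj : j ≠ i) :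
            W (σ (i.castSucc.succAbove j)) = (Fin.cons (a * b) w : Fin (k + 1) → G) (π j) := by
          obtain ⟨p, hp⟩ := Fin.exists_succ_eq.2
            (show π j ≠ 0 from fun e => hj (π.injective (e.trans hπ.symm)))
          rw [hσs, hW, Fin.cons_succ, ← hp, Fin.cons_succ, Fin.cons_succ]
        funext j
        rcases lt_trichotomy j i with h | rfl | h
        · rw [Fin.contractNth_apply_of_lt _ _ _ _ (show (j : ℕ) < (i.castSucc : ℕ) from h),
            Function.comp_apply, Function.comp_apply, ← hrest j h.ne,
            Fin.succAbove_of_castSucc_lt _ _ (Fin.castSucc_lt_castSucc_iff.2 h)]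
        · rw [Fin.contractNth_apply_of_eq _ _ _ _ rfl]
          simp [hσ0, hσ1, hπ, hW]
        · rw [Fin.contractNth_apply_of_gt _ _ _ _ (show (i.castSucc : ℕ) < (j : ℕ) from h),
            Function.comp_apply, Function.comp_apply, ← hrest j h.ne',
            Fin.succAbove_of_le_castSucc _ _ (Fin.castSucc_le_castSucc_iff.2 h.le)]
      rw [hs, hw]
      ring
    · simp
  · intro p _
    refine Finset.sum_eq_zero fun π _ => ?_
    rw [Equiv.coe_mulRight, hχ]
    simp only [Equiv.Perm.inv_eq_iff_eq]
    rw [if_neg, zero_mul]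
    rintro ⟨e, -⟩
    rw [Equiv.Perm.mul_apply, Fin.cycleRange_self, decomposeFin_symm_apply_zero] at e
    exact Fin.succ_ne_zero p e.symm

/-- Take the half of the cube on `a`, `b`, `w` in which `a` precedes `b`. Its diagonal wall is the
cube on `a * b`, `w`; of its outer faces, only those starting with `a` or `b` fail to cancel, and
they are the cubes on `b`, `w` and on `a`, `w`. -/
theorem altSum_cons_mul {k : ℕ} {c : (Fin (k + 2) → G) → ℂ} (hc : IsHomogeneousCocycle c)
    (hinv : ∀ g t, c (fun j => g * t j) = c t) (a b : G) (w : Fin k → G) :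
    altSum c (Fin.cons (a * b) w : Fin (k + 1) → G) =
      altSum c (Fin.cons a w : Fin (k + 1) → G) + altSum c (Fin.cons b w : Fin (k + 1) → G) := by
  set W : Fin (k + 2) → G := Fin.cons a (Fin.cons b w) with hW
  have h := weighted_cube_boundary hc W orderWeight
  simp only [hinv, ← sub_mul, orderWeight_sub_finRotate] at h
  have hr : ∑ i : Fin (k + 1), (-1 : ℂ) ^ (i : ℕ) * ∑ σ, orderWeight σ * (sgn σ *
        c (Fin.partialProd (Fin.contractNth i.castSucc (· * ·) (W ∘ σ)))) =
      altSum c (Fin.cons (a * b) w : Fin (k + 1) → G) := by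
    simp only [hW, sum_orderWeight_contractNth, Finset.mul_sum]
    rw [Finset.sum_comm]
    refine Finset.sum_congr rfl fun π _ => ?_
    rw [Finset.sum_eq_single (π⁻¹ 0)]
    · rw [if_pos (by simp), ← mul_assoc, ← mul_pow]
      simp [sgn]
    · intro i _ hi
      rw [if_neg, mul_zero]
      rintro e
      exact hi (by rw [← e]; simp)
    · simp
  rw [hr] at h
  rw [← h, sum_perm_eq_sum_decompose, Fin.sum_univ_succ, Fin.sum_univ_succ,
    Finset.sum_eq_zero (f := fun p : Fin k => _)]
  · have h0 (π : Equiv.Perm (Fin (k + 1))) :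
        (Fin.tail (W ∘ (decomposeFin.symm (0, π) : Equiv.Perm (Fin (k + 2)))) :
          Fin (k + 1) → G) = (Fin.cons b w : Fin (k + 1) → G) ∘ π := by
      rw [tail_comp_decomposeFin_zero, hW, Fin.tail_cons]
    have h1 (π : Equiv.Perm (Fin (k + 1))) :
        (Fin.tail (W ∘ (decomposeFin.symm (Fin.succ 0, π) : Equiv.Perm (Fin (k + 2)))) :
          Fin (k + 1) → G) = (Fin.cons a w : Fin (k + 1) → G) ∘ π := by
      funext j
      simp only [Fin.tail, Function.comp_apply, decomposeFin_symm_apply_succ, hW]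
      rcases Fin.eq_zero_or_eq_succ (π j) with h | ⟨p, h⟩
      · rw [h, Equiv.swap_apply_right]; simp
      · rw [h, Equiv.swap_apply_of_ne_of_ne (Fin.succ_ne_zero _)
          (fun e => Fin.succ_ne_zero _ (Fin.succ_injective _ e))]
        simp
    simp only [decomposeFin_symm_apply_zero, h0, h1, decomposeFin.symm_sign, sgn, altSum]
    simp
    ring
  · intro p _
    refine Finset.sum_eq_zero fun π _ => ?_
    rw [decomposeFin_symm_apply_zero, if_neg (Fin.succ_ne_zero _), if_neg, zero_mul, mul_zero]
    exact fun e => Fin.succ_ne_zero p (Fin.succ_injective _ e)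

end AltSum

/-! ### Multilinearity of cube sums, regulators and indices, and orbit sums over subgroups. -/

section OrbitSum

variable {G : Type*} [CommGroup G] {d : ℕ}

theorem altSum_update_mul {c : (Fin (d + 1) → G) → ℂ} (hc : IsHomogeneousCocycle c)
    (hinv : ∀ g t, c (fun j => g * t j) = c t) (w : Fin d → G) (i : Fin d) (a b : G) :
    altSum c (Function.update w i (a * b)) =
      altSum c (Function.update w i a) + altSum c (Function.update w i b) := by
  cases d with
  | zero => exact i.elim0
  | succ k =>
    have key (z : G) : altSum c (Function.update w i z) = sgn (Equiv.swap 0 i) *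
        altSum c (Fin.cons z (Fin.tail (w ∘ Equiv.swap 0 i)) : Fin (k + 1) → G) := by
      have h : (Fin.cons z (Fin.tail (w ∘ Equiv.swap 0 i)) : Fin (k + 1) → G) =
          Function.update w i z ∘ Equiv.swap 0 i := by
        rw [Function.update_comp_equiv, Equiv.symm_swap, Equiv.swap_apply_right]
        conv_rhs => rw [← Fin.cons_self_tail (w ∘ Equiv.swap 0 i)]
        exact (Fin.update_cons_zero _ _ _).symm
      rw [h, altSum_comp_perm, ← mul_assoc]
      have h2 : sgn (Equiv.swap 0 i) * sgn (Equiv.swap 0 i) = 1 := by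
        rw [sgn, ← Int.cast_mul, ← Units.val_mul, Int.units_mul_self]
        simp
      rw [h2, one_mul]
    rw [key, key, key, altSum_cons_mul hc hinv, mul_add]

/-- The alternating sums of an invariant cocycle form an alternating map. -/
def altSumAlternatingMap {c : (Fin (d + 1) → G) → ℂ} (hc : IsHomogeneousCocycle c)
    (hinv : ∀ g t, c (fun j => g * t j) = c t) : Additive G [⋀^Fin d]→ₗ[ℤ] ℂ where
  toFun w := altSum c fun i => (w i).toMul
  map_update_add' {inst} w i a b := by
    obtain rfl : inst = instDecidableEqFin d := Subsingleton.elim _ _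
    have key (z : Additive G) : (fun j => (Function.update w i z j).toMul) =
        Function.update (fun j => (w j).toMul) i z.toMul :=
      Function.comp_update (Additive.toMul) w i z
    rw [key, key, key, toMul_add, altSum_update_mul hc hinv]
  map_update_smul' {inst} w i n a := by
    obtain rfl : inst = instDecidableEqFin d := Subsingleton.elim _ _
    have key (z : Additive G) : (fun j => (Function.update w i z j).toMul) =
        Function.update (fun j => (w j).toMul) i z.toMul :=
      Function.comp_update (Additive.toMul) w i z
    let f : Additive G →+ ℂ := AddMonoidHom.mk'
      (fun z => altSum c (Function.update (fun j => (w j).toMul) i z.toMul))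
      fun a b => by rw [toMul_add, altSum_update_mul hc hinv]
    rw [key, key]
    exact map_zsmul f n a
  map_eq_zero_of_eq' w i j h hij := altSum_eq_zero_of_eq c _ hij (congrArg Additive.toMul h)

theorem alternatingMap_eq_det_smul {A N ι : Type*} [AddCommGroup A] [AddCommGroup N] [Fintype ι]
    [DecidableEq ι] (e : Module.Basis ι ℤ A) (f : A [⋀^ι]→ₗ[ℤ] N) (v : ι → A) :
    f v = e.det v • f e := by
  have h : f = (LinearMap.toSpanSingleton ℤ N (f e)).compAlternatingMap e.det := by
    refine Module.Basis.ext_alternating e fun s hs => ?_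
    obtain ⟨σ, hσ⟩ : ∃ σ : Equiv.Perm ι, s = σ :=
      ⟨Equiv.ofBijective s (Finite.injective_iff_bijective.1 hs), rfl⟩
    have h1 := f.map_perm e σ
    have h2 := e.det.map_perm e σ
    subst hσ
    simp only [Function.comp_def] at h1 h2
    simp [h1, h2, Module.Basis.det_self]
  conv_lhs => rw [h]
  simp

/-- The determinant of the images of `w` under a homomorphism to `ℝ^d`. -/
def logDet (L : Additive G →+ (Fin d → ℝ)) (w : Fin d → G) : ℝ :=
  (Matrix.of fun i j => L (Additive.ofMul (w j)) i).det

/-- A linear form on `ℝ^d` killing the images of all `w j` kills the image of the group they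
generate, hence that of each `w' j`, since `ℝ` is torsion-free. -/
theorem logDet_ne_zero_of_pow_mem {L : Additive G →+ (Fin d → ℝ)} {w w' : Fin d → G}
    (h : ∀ j, ∃ k : ℕ, k ≠ 0 ∧ w' j ^ k ∈ Subgroup.closure (Set.range w))
    (hw' : logDet L w' ≠ 0) : logDet L w ≠ 0 := by
  intro h0
  obtain ⟨v, hv, hv0⟩ := Matrix.exists_vecMul_eq_zero_iff.2 h0
  have hker : ∀ g ∈ Subgroup.closure (Set.range w), ∑ i, v i * L (Additive.ofMul g) i = 0 := by
    intro g hg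
    induction hg using Subgroup.closure_induction with
    | mem x hx =>
      obtain ⟨j, rfl⟩ := hx
      exact congrFun hv0 j
    | one => simp
    | mul x y _ _ hx hy => simp [mul_add, Finset.sum_add_distrib, hx, hy]
    | inv x _ hx => simp [hx]
  refine hv (Matrix.eq_zero_of_vecMul_eq_zero hw' ?_)
  funext j
  obtain ⟨k, hk, hmem⟩ := h j
  have h1 := hker _ hmem
  have h2 : ∑ i, v i * L (Additive.ofMul (w' j ^ k)) i =
      k * ∑ i, v i * L (Additive.ofMul (w' j)) i := by
    rw [Finset.mul_sum]
    refine Finset.sum_congr rfl fun i _ => ?_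
    rw [ofMul_pow, map_nsmul, Pi.smul_apply, nsmul_eq_mul, mul_left_comm]
  rw [h2] at h1
  exact (mul_eq_zero.1 h1).resolve_left (by exact_mod_cast hk)

theorem linearIndependent_of_logDet_ne_zero {L : Additive G →+ (Fin d → ℝ)} {w : Fin d → G}
    (hw : logDet L w ≠ 0) : LinearIndependent ℤ fun j => Additive.ofMul (w j) := by
  rw [Fintype.linearIndependent_iff]
  intro g hg j
  have h1 : Matrix.mulVec (Matrix.of fun i j => L (Additive.ofMul (w j)) i)
      (fun j => (g j : ℝ)) = 0 := by
    funext i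
    have := congrFun (congrArg L hg) i
    simp only [map_sum, map_zsmul, Finset.sum_apply, zsmul_eq_mul, map_zero,
      Pi.zero_apply] at this
    simpa [Matrix.mulVec, dotProduct, mul_comm] using this
  have := congrFun (Matrix.eq_zero_of_mulVec_eq_zero hw h1) j
  simpa using this

theorem span_range_ofMul (w : Fin d → G) :
    (Submodule.span ℤ (Set.range fun j => Additive.ofMul (w j))).toAddSubgroup =
      Subgroup.toAddSubgroup (Subgroup.closure (Set.range w)) := by
  rw [Submodule.span_int_eq_addSubgroupClosure, Subgroup.toAddSubgroup_closure]
  congr 1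

/-- A basis of `G` made of generators with nonzero logarithmic determinant. -/
def basisOfLogDet {L : Additive G →+ (Fin d → ℝ)} {w : Fin d → G} (hw : logDet L w ≠ 0)
    (htop : Subgroup.closure (Set.range w) = ⊤) : Module.Basis (Fin d) ℤ (Additive G) :=
  Module.Basis.mk (linearIndependent_of_logDet_ne_zero hw) (by
    rw [← Submodule.toAddSubgroup_le, span_range_ofMul, htop]
    exact le_of_eq (by ext; simp))

theorem coe_basisOfLogDet {L : Additive G →+ (Fin d → ℝ)} {w : Fin d → G} (hw : logDet L w ≠ 0)
    (htop : Subgroup.closure (Set.range w) = ⊤) :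
    ⇑(basisOfLogDet hw htop) = fun j => Additive.ofMul (w j) :=
  Module.Basis.coe_mk _ _

theorem logDet_eq_det_mul {L : Additive G →+ (Fin d → ℝ)} {w : Fin d → G} (hw : logDet L w ≠ 0)
    (htop : Subgroup.closure (Set.range w) = ⊤) (w' : Fin d → G) :
    logDet L w' = ((basisOfLogDet hw htop).det fun j => Additive.ofMul (w' j) : ℤ) *
      logDet L w := by
  set e := basisOfLogDet hw htop with he
  have h1 : (Matrix.of fun i j => L (Additive.ofMul (w' j)) i) =
      (Matrix.of fun i j => L (Additive.ofMul (w j)) i) *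
        (e.toMatrix fun j => Additive.ofMul (w' j)).map (Int.castRingHom ℝ) := by
    ext i j
    have h2 := e.sum_repr (Additive.ofMul (w' j))
    rw [Matrix.of_apply, ← h2, map_sum, Finset.sum_apply, Matrix.mul_apply]
    refine Finset.sum_congr rfl fun k _ => ?_
    rw [map_zsmul, he, coe_basisOfLogDet]
    simp [Module.Basis.toMatrix_apply, mul_comm]
  rw [logDet, h1, Matrix.det_mul, ← RingHom.mapMatrix_apply, ← RingHom.map_det, mul_comm,
    Module.Basis.det_apply]
  rfl

theorem natAbs_det_eq_index {L : Additive G →+ (Fin d → ℝ)} {w w' : Fin d → G}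
    (hw : logDet L w ≠ 0) (htop : Subgroup.closure (Set.range w) = ⊤) (hw' : logDet L w' ≠ 0) :
    ((basisOfLogDet hw htop).det fun j => Additive.ofMul (w' j)).natAbs =
      (Subgroup.closure (Set.range w')).index := by
  have hfin : Module.Finite ℤ (Additive G) := Module.Finite.of_basis (basisOfLogDet hw htop)
  have hfree : Module.Free ℤ (Additive G) := Module.Free.of_basis (basisOfLogDet hw htop)
  have h := Submodule.natAbs_det_basis_change (basisOfLogDet hw htop) _
    (Module.Basis.span (linearIndependent_of_logDet_ne_zero hw'))
  rw [← Subgroup.index_toAddSubgroup, ← span_range_ofMul]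
  rw [← Submodule.cardQuot_apply] at h
  refine Eq.trans ?_ h
  congr 2
  funext j
  simp [Module.Basis.span_apply]

/-- The sum of the translates of `Φ` under a subgroup. -/
def orbitSum (H : Subgroup G) (Φ : (Fin (d + 1) → G) → ℂ) (t : Fin (d + 1) → G) : ℂ :=
  ∑' h : H, Φ fun k => h * t k

variable {Φ : (Fin (d + 1) → G) → ℂ}

theorem isHomogeneousCocycle_orbitSum (H : Subgroup G) (hΦ : IsHomogeneousCocycle Φ)
    (hs : ∀ t : Fin (d + 1) → G, Summable fun g : G => Φ fun k => g * t k) :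
    IsHomogeneousCocycle (orbitSum H Φ) := by
  intro t
  have hs' (j : Fin (d + 2)) : Summable fun h : H => (-1 : ℂ) ^ (j : ℕ) *
      Φ (fun k => h * (t ∘ j.succAbove) k) :=
    ((hs _).comp_injective (Subtype.val_injective (p := (· ∈ H)))).mul_left _
  simp only [orbitSum, ← tsum_mul_left]
  rw [← Summable.tsum_finsetSum fun j _ => hs' j]
  have h0 (h : H) : ∑ j : Fin (d + 2), (-1 : ℂ) ^ (j : ℕ) *
      Φ (fun k => h * (t ∘ j.succAbove) k) = 0 := hΦ fun k => h * t k
  rw [tsum_congr h0, tsum_zero]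

theorem orbitSum_mul_left (H : Subgroup G) (Φ : (Fin (d + 1) → G) → ℂ) {g : G} (hg : g ∈ H)
    (t : Fin (d + 1) → G) : orbitSum H Φ (fun k => g * t k) = orbitSum H Φ t := by
  unfold orbitSum
  rw [← Equiv.tsum_eq (Equiv.mulRight (⟨g, hg⟩ : H)) fun h : H => Φ fun k => h * t k]
  simp [mul_assoc]

theorem orbitSum_top_eq (H : Subgroup G) [Fintype (G ⧸ H)]
    (hs : ∀ t : Fin (d + 1) → G, Summable fun g : G => Φ fun k => g * t k) (t : Fin (d + 1) → G) :
    orbitSum ⊤ Φ t = ∑ q : G ⧸ H, orbitSum H Φ fun k => q.out * t k := by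
  have h1 : orbitSum ⊤ Φ t = ∑' g : G, Φ fun k => g * t k :=
    (Equiv.Set.univ G).tsum_eq fun g : G => Φ fun k => g * t k
  have hbij : Function.Bijective fun p : (G ⧸ H) × H => p.1.out * (p.2 : G) := by
    constructor
    · rintro ⟨q, h⟩ ⟨q', h'⟩ e
      have hq (q : G ⧸ H) (h : H) : ((q.out * h : G) : G ⧸ H) = q := by
        rw [QuotientGroup.mk_mul_of_mem _ h.2, QuotientGroup.out_eq']
      obtain rfl : q = q' := by rw [← hq q h, ← hq q' h']; exact congrArg _ e
      simpa using e
    · intro g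
      exact ⟨(g, ⟨(g : G ⧸ H).out⁻¹ * g, QuotientGroup.eq.1 (QuotientGroup.out_eq' _)⟩), by simp⟩
  let e : (G ⧸ H) × H ≃ G := Equiv.ofBijective _ hbij
  have he (q : G ⧸ H) (h : H) : e (q, h) = q.out * h := rfl
  rw [h1, ← e.tsum_eq, Summable.tsum_prod (f := fun p => Φ fun k => e p * t k)
    ((e.summable_iff).2 (hs t)), tsum_fintype]
  refine Finset.sum_congr rfl fun q _ => tsum_congr fun h => ?_
  rw [he]
  congr 1
  funext k
  rw [mul_comm q.out, mul_assoc]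

/-- Each coset of `H` contributes a translate of the orbit sum over `H`. The edges lie in `H`, so
`altSum_translate` makes the contributions equal. -/
theorem altSum_orbitSum_top (H : Subgroup G) [H.FiniteIndex] (hΦ : IsHomogeneousCocycle Φ)
    (hs : ∀ t : Fin (d + 1) → G, Summable fun g : G => Φ fun k => g * t k) {w : Fin d → G} (hw : ∀ i, w i ∈ H) :
    altSum (orbitSum ⊤ Φ) w = H.index * altSum (orbitSum H Φ) w := by
  let _ := H.fintypeQuotientOfFiniteIndex
  have h (g : G) := altSum_translate (isHomogeneousCocycle_orbitSum H hΦ hs) w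
    (fun i t => orbitSum_mul_left H Φ (hw i) t) g
  have h1 : altSum (orbitSum ⊤ Φ) w =
      ∑ q : G ⧸ H, altSum (fun t => orbitSum H Φ fun k => q.out * t k) w := by
    simp only [altSum, orbitSum_top_eq H hs, Finset.mul_sum]
    rw [Finset.sum_comm]
  rw [h1, Finset.sum_congr rfl fun q _ => h q.out, Finset.sum_const, nsmul_eq_mul,
    Finset.card_univ, ← Nat.card_eq_fintype_card]
  rfl

/-- The signed alternating sum of orbit sums of a cocycle depends neither on the generators nor on
the subgroup of finite index. -/
theorem sign_mul_altSum_orbitSum (L : Additive G →+ (Fin d → ℝ)) (hΦ : IsHomogeneousCocycle Φ)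
    (H : Subgroup G) [H.FiniteIndex] {w w' : Fin d → G}
    (hs : logDet L w ≠ 0 → ∀ t : Fin (d + 1) → G, Summable fun g : G => Φ fun k => g * t k)
    (hw : Subgroup.closure (Set.range w) = ⊤) (hw' : Subgroup.closure (Set.range w') = H) :
    ((SignType.sign (logDet L w) : ℤ) : ℂ) * altSum (orbitSum ⊤ Φ) w =
      ((SignType.sign (logDet L w') : ℤ) : ℂ) * altSum (orbitSum H Φ) w' := by
  -- Here both signs are `0` and the identity is trivial; this is why `hs` is only assumed for a
  -- nonzero determinant.
  by_cases h0 : logDet L w = 0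
  · have h0' : logDet L w' = 0 := by
      by_contra h
      exact logDet_ne_zero_of_pow_mem (fun j => ⟨1, one_ne_zero, by simp [hw]⟩) h h0
    simp [h0, h0']
  have hs := hs h0
  have h0' : logDet L w' ≠ 0 := by
    refine logDet_ne_zero_of_pow_mem (fun j => ⟨H.index, Subgroup.FiniteIndex.index_ne_zero, ?_⟩) h0
    rw [hw']
    exact Subgroup.pow_index_mem H _
  set D := (basisOfLogDet h0 hw).det fun j => Additive.ofMul (w' j) with hD
  have hidx : D.natAbs = H.index := by rw [hD, natAbs_det_eq_index h0 hw h0', hw']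
  have hsign : SignType.sign (logDet L w') = SignType.sign D * SignType.sign (logDet L w) := by
    rw [logDet_eq_det_mul h0 hw w', sign_mul, ← hD]
    congr 1
    rcases lt_trichotomy D 0 with h | h | h
    · rw [sign_neg h, sign_neg (by exact_mod_cast h)]
    · simp [h]
    · rw [sign_pos h, sign_pos (by exact_mod_cast h)]
  have hmem (j : Fin d) : w' j ∈ H := hw' ▸ Subgroup.subset_closure ⟨j, rfl⟩
  have h1 := altSum_orbitSum_top H hΦ hs hmem
  have h2 := alternatingMap_eq_det_smul (basisOfLogDet h0 hw)
    (altSumAlternatingMap (isHomogeneousCocycle_orbitSum ⊤ hΦ hs)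
      fun g t => orbitSum_mul_left ⊤ Φ (Subgroup.mem_top g) t) fun j => Additive.ofMul (w' j)
  rw [coe_basisOfLogDet, ← hD] at h2
  change altSum (orbitSum ⊤ Φ) w' = D • altSum (orbitSum ⊤ Φ) w at h2
  have hne : (H.index : ℂ) ≠ 0 := by exact_mod_cast Subgroup.FiniteIndex.index_ne_zero
  have h3 : ((SignType.sign D : ℤ) : ℂ) * D = H.index := by
    rw [← hidx, ← Int.cast_natCast, Int.natCast_natAbs, ← Int.cast_mul, sign_mul_self]
  have h4 : ((SignType.sign D : ℤ) : ℂ) * ((SignType.sign D : ℤ) : ℂ) = 1 := by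
    have hD0 : D ≠ 0 := by
      intro e
      rw [e] at hidx
      exact Subgroup.FiniteIndex.index_ne_zero hidx.symm
    rcases hD0.lt_or_gt with h | h
    · simp [sign_neg h]
    · simp [sign_pos h]
  rw [h1, zsmul_eq_mul] at h2
  -- Cancel `[G : H] = |D|` between the coset count `h1` and multilinearity `h2`; the factor `sign
  -- D` remains.
  have h5 : altSum (orbitSum H Φ) w' =
      ((SignType.sign D : ℤ) : ℂ) * altSum (orbitSum ⊤ Φ) w := by
    refine mul_left_cancel₀ hne ?_
    rw [h2, ← h3]
    linear_combination (-(D : ℂ) * altSum (orbitSum ⊤ Φ) w) * h4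
  rw [hsign, h5, SignType.coe_mul, Int.cast_mul]
  linear_combination (-((SignType.sign (logDet L w) : ℤ) : ℂ) * altSum (orbitSum ⊤ Φ) w) * h4

end OrbitSum

/-! ### Differential operators on polynomials in reciprocals of linear forms -/

section Reciprocals

variable {n : ℕ} {ι : Type*}

/-- The derivation of `ℂ[X_k]` modelling `-∂/∂x_i` when `X_k` stands for `1 / ⟨x, σ_k⟩`. -/
def recipDerivation (σ : Matrix (Fin n) ι ℂ) (i : Fin n) :
    Derivation ℂ (MvPolynomial ι ℂ) (MvPolynomial ι ℂ) :=
  MvPolynomial.mkDerivation ℂ fun k => MvPolynomial.C (σ i k) * MvPolynomial.X k ^ 2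

/-- Substitution of `1 / ⟨y, σ_k⟩` for `X_k`. -/
def recipEval (σ : Matrix (Fin n) ι ℂ) (y : Fin n → ℂ) : MvPolynomial ι ℂ →ₐ[ℂ] ℂ :=
  MvPolynomial.aeval fun k => (Matrix.vecMul y σ k)⁻¹

theorem recipDerivation_X (σ : Matrix (Fin n) ι ℂ) (i : Fin n) (k : ι) :
    recipDerivation σ i (MvPolynomial.X k) = MvPolynomial.C (σ i k) * MvPolynomial.X k ^ 2 :=
  MvPolynomial.mkDerivation_X ..

theorem recipEval_X (σ : Matrix (Fin n) ι ℂ) (y : Fin n → ℂ) (k : ι) :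
    recipEval σ y (MvPolynomial.X k) = (Matrix.vecMul y σ k)⁻¹ :=
  MvPolynomial.aeval_X ..

/-- The commutator is again a derivation, so it suffices to test it on the variables. Commutation is
what allows polynomials in these operators. -/
theorem recipDerivation_comm (σ : Matrix (Fin n) ι ℂ) (i j : Fin n) (q : MvPolynomial ι ℂ) :
    recipDerivation σ i (recipDerivation σ j q) = recipDerivation σ j (recipDerivation σ i q) := by
  have h : ⁅recipDerivation σ i, recipDerivation σ j⁆ = 0 := by
    refine MvPolynomial.derivation_ext fun k => ?_
    simp only [Derivation.commutator_apply, recipDerivation_X, Derivation.leibniz,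
      Derivation.leibniz_pow, smul_eq_mul, Derivation.coe_zero,
      Pi.zero_apply, ← MvPolynomial.algebraMap_eq, Derivation.map_algebraMap, nsmul_eq_mul]
    ring
  have := DFunLike.congr_fun h q
  rwa [Derivation.commutator_apply, Derivation.coe_zero, Pi.zero_apply, sub_eq_zero] at this

theorem hasLineDerivAt_recipEval (σ : Matrix (Fin n) ι ℂ) (i : Fin n) (q : MvPolynomial ι ℂ)
    {y : Fin n → ℂ} (hy : ∀ k, Matrix.vecMul y σ k ≠ 0) :
    HasLineDerivAt ℂ (fun y => recipEval σ y q) (-recipEval σ y (recipDerivation σ i q)) y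
      (Pi.single i 1) := by
  unfold HasLineDerivAt
  induction q using MvPolynomial.induction_on with
  | C a =>
    rw [← MvPolynomial.algebraMap_eq, Derivation.map_algebraMap, map_zero, neg_zero]
    simp only [AlgHom.commutes]
    exact hasDerivAt_const _ _
  | add p q hp hq =>
    simp only [map_add, neg_add]
    exact hp.add hq
  | mul_X p k hp =>
    have hlin : HasDerivAt (fun t : ℂ => Matrix.vecMul (y + t • Pi.single i 1) σ k) (σ i k) 0 := by
      have h : (fun t : ℂ => Matrix.vecMul (y + t • Pi.single i 1) σ k) =
          fun t => Matrix.vecMul y σ k + t * σ i k := by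
        funext t
        simp [Matrix.add_vecMul, Matrix.smul_vecMul]
      rw [h]
      simpa using ((hasDerivAt_id (0 : ℂ)).mul_const (σ i k)).const_add (Matrix.vecMul y σ k)
    have hinv := hlin.fun_inv (by simpa using hy k)
    have h := hp.mul hinv
    simp only [zero_smul, add_zero] at h
    simp only [map_mul, recipEval_X, Derivation.leibniz, recipDerivation_X, smul_eq_mul, map_add,
      map_pow]
    refine h.congr_deriv ?_
    have hC : recipEval σ y (MvPolynomial.C (σ i k)) = σ i k := MvPolynomial.aeval_C ..
    rw [hC]
    field_simp
    ring

/-- The set where none of the linear forms given by the columns of `σ` vanishes. -/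
def nonvanishing (σ : Matrix (Fin n) ι ℂ) : Set (Fin n → ℂ) :=
  {y | ∀ k, Matrix.vecMul y σ k ≠ 0}

theorem isOpen_nonvanishing [Finite ι] (σ : Matrix (Fin n) ι ℂ) : IsOpen (nonvanishing σ) := by
  have h : nonvanishing σ = ⋂ k, {y | Matrix.vecMul y σ k ≠ 0} := by
    ext y
    simp [nonvanishing]
  rw [h]
  refine isOpen_iInter_of_finite fun k => isOpen_ne_fun ?_ continuous_const
  simp only [Matrix.vecMul, dotProduct]
  fun_prop

theorem negPartial_eqOn [Finite ι] (σ : Matrix (Fin n) ι ℂ) (i : Fin n)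
    {g : (Fin n → ℂ) → ℂ} {q : MvPolynomial ι ℂ}
    (hg : Set.EqOn g (fun y => recipEval σ y q) (nonvanishing σ)) :
    Set.EqOn (negPartial i g) (fun y => recipEval σ y (recipDerivation σ i q))
      (nonvanishing σ) := by
  intro y hy
  have h1 : g =ᶠ[nhds y] fun y => recipEval σ y q :=
    Filter.eventuallyEq_of_mem ((isOpen_nonvanishing σ).mem_nhds hy) hg
  rw [negPartial, h1.lineDeriv_eq, (hasLineDerivAt_recipEval σ i q hy).lineDeriv, neg_neg]

theorem negPartial_foldr_eqOn [Finite ι] (σ : Matrix (Fin n) ι ℂ) (s : Fin n →₀ ℕ)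
    (L : List (Fin n)) {g : (Fin n → ℂ) → ℂ} {q : MvPolynomial ι ℂ}
    (hg : Set.EqOn g (fun y => recipEval σ y q) (nonvanishing σ)) :
    Set.EqOn (L.foldr (fun i h => (negPartial i)^[s i] h) g)
      (fun y => recipEval σ y
        ((L.map fun i => ((recipDerivation σ i : Module.End ℂ (MvPolynomial ι ℂ))) ^ s i).prod q))
      (nonvanishing σ) := by
  induction L with
  | nil => exact hg
  | cons i L ih =>
    rw [List.foldr_cons, List.map_cons, List.prod_cons, Module.End.mul_apply]
    generalize List.foldr _ g L = g' at ih ⊢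
    generalize (List.prod (List.map _ L) : Module.End ℂ (MvPolynomial ι ℂ)) q = q' at ih ⊢
    generalize s i = k
    induction k with
    | zero => simpa using ih
    | succ k ihk =>
      rw [Function.iterate_succ_apply', pow_succ', Module.End.mul_apply]
      exact negPartial_eqOn σ i ihk

open scoped IsMulCommutative in
/-- The algebra homomorphism `P ↦ P(-∂)` on the model. -/
def recipOp (σ : Matrix (Fin n) ι ℂ) :
    MvPolynomial (Fin n) ℂ →ₐ[ℂ] Module.End ℂ (MvPolynomial ι ℂ) :=
  -- Evaluating a polynomial needs a commutative target: the subalgebra generated by the commuting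
  -- derivations.
  haveI : IsMulCommutative (Algebra.adjoin ℂ (Set.range fun i =>
      (recipDerivation σ i : Module.End ℂ (MvPolynomial ι ℂ)))) :=
    Algebra.isMulCommutative_adjoin ℂ (by
      rintro _ ⟨i, rfl⟩ _ ⟨j, rfl⟩
      exact LinearMap.ext (recipDerivation_comm σ i j))
  (Subalgebra.val _).comp (MvPolynomial.aeval fun i =>
    (⟨_, Algebra.subset_adjoin ⟨i, rfl⟩⟩ : Algebra.adjoin ℂ (Set.range fun i =>
      (recipDerivation σ i : Module.End ℂ (MvPolynomial ι ℂ)))))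

open scoped IsMulCommutative in
theorem recipOp_X (σ : Matrix (Fin n) ι ℂ) (i : Fin n) :
    recipOp σ (MvPolynomial.X i) = (recipDerivation σ i : Module.End ℂ (MvPolynomial ι ℂ)) := by
  simp [recipOp]

theorem recipOp_apply (σ : Matrix (Fin n) ι ℂ) (P : MvPolynomial (Fin n) ℂ)
    (q : MvPolynomial ι ℂ) : recipOp σ P q = ∑ s ∈ P.support, P.coeff s •
      ((List.finRange n).map fun i =>
        (recipDerivation σ i : Module.End ℂ (MvPolynomial ι ℂ)) ^ s i).prod q := by
  conv_lhs => rw [P.as_sum]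
  rw [map_sum, LinearMap.sum_apply]
  refine Finset.sum_congr rfl fun s _ => ?_
  have h : MvPolynomial.monomial s (P.coeff s) = P.coeff s •
      ((List.finRange n).map fun i => (MvPolynomial.X i : MvPolynomial (Fin n) ℂ) ^ s i).prod := by
    rw [MvPolynomial.monomial_eq, Finsupp.prod_fintype _ _ fun i => pow_zero _, Fin.prod_univ_def,
      MvPolynomial.smul_eq_C_mul]
  rw [h, map_smul, LinearMap.smul_apply, map_list_prod, List.map_map]
  simp only [Function.comp_def, map_pow, recipOp_X]

theorem polyDiff_eqOn [Finite ι] (σ : Matrix (Fin n) ι ℂ) (P : MvPolynomial (Fin n) ℂ)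
    {g : (Fin n → ℂ) → ℂ} {q : MvPolynomial ι ℂ}
    (hg : Set.EqOn g (fun y => recipEval σ y q) (nonvanishing σ)) :
    Set.EqOn (polyDiff P g) (fun y => recipEval σ y (recipOp σ P q)) (nonvanishing σ) := by
  intro y hy
  simp only [polyDiff, recipOp_apply, map_sum, map_smul, smul_eq_mul]
  refine Finset.sum_congr rfl fun s _ => ?_
  rw [negPartialMonomial, negPartial_foldr_eqOn σ s _ hg hy]

theorem derivation_sum_apply {α W : Type*} [CommRing W] [Algebra ℂ W] (s : Finset α)
    (D : α → Derivation ℂ W W) (q : W) : (∑ j ∈ s, D j) q = ∑ j ∈ s, D j q := by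
  have h := congrFun (map_sum (Derivation.coeFnAddMonoidHom (R := ℂ) (A := W) (M := W)) D s) q
  simpa only [Derivation.coeFnAddMonoidHom, AddMonoidHom.coe_mk, ZeroHom.coe_mk,
    Finset.sum_apply] using h

/-- The chain rule: the derivations depend linearly on the rows of the matrix, so multiplying by `A`
amounts to a linear substitution in `P`. -/
theorem recipOp_mul (A : Matrix (Fin n) (Fin n) ℂ) (σ : Matrix (Fin n) ι ℂ) :
    recipOp (A * σ) = (recipOp σ).comp (MvPolynomial.aeval fun i =>
      ∑ j, MvPolynomial.C (A i j) * MvPolynomial.X j) := by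
  refine MvPolynomial.algHom_ext fun i => ?_
  rw [AlgHom.comp_apply, MvPolynomial.aeval_X, recipOp_X, map_sum]
  have h : recipDerivation (A * σ) i = ∑ j, A i j • recipDerivation σ j := by
    refine MvPolynomial.derivation_ext fun k => ?_
    rw [recipDerivation_X, Matrix.mul_apply, map_sum, Finset.sum_mul]
    simp only [derivation_sum_apply, Derivation.coe_smul, Pi.smul_apply,
      recipDerivation_X, map_mul, MvPolynomial.smul_eq_C_mul, mul_assoc]
  refine LinearMap.ext fun q => ?_
  rw [h]
  simp [← MvPolynomial.smul_eq_C_mul, recipOp_X, derivation_sum_apply]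

theorem recipEval_mul (A : Matrix (Fin n) (Fin n) ℂ) (σ : Matrix (Fin n) ι ℂ) (y : Fin n → ℂ) :
    recipEval (A * σ) y = recipEval σ (Matrix.vecMul y A) := by
  simp only [recipEval, Matrix.vecMul_vecMul]

/-- Each derivation sends `X k` to a multiple of itself, so it preserves the ideal of `∏ X k`. Hence
derivatives keep a factor `1 / ⟨y, σ_k⟩` for every `k`, the source of decay. -/
theorem dvd_recipOp [Fintype ι] (σ : Matrix (Fin n) ι ℂ) (P : MvPolynomial (Fin n) ℂ)
    {q : MvPolynomial ι ℂ} (hq : ∏ k, MvPolynomial.X k ∣ q) :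
    ∏ k, MvPolynomial.X k ∣ recipOp σ P q := by
  have h0 (i : Fin n) (s : Finset ι) : ∏ k ∈ s, MvPolynomial.X k ∣
      recipDerivation σ i (∏ k ∈ s, MvPolynomial.X k) := by
    classical
    induction s using Finset.induction_on with
    | empty => simp
    | insert k s hk ih =>
      rw [Finset.prod_insert hk, Derivation.leibniz, recipDerivation_X, smul_eq_mul, smul_eq_mul]
      refine dvd_add (mul_dvd_mul_left _ ih) ⟨MvPolynomial.C (σ i k) * MvPolynomial.X k, ?_⟩
      ring
  induction P using MvPolynomial.induction_on generalizing q with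
  | C a =>
    rw [← MvPolynomial.algebraMap_eq, AlgHom.commutes, Module.algebraMap_end_apply]
    rw [MvPolynomial.smul_eq_C_mul]
    exact hq.mul_left _
  | add P Q hP hQ =>
    rw [map_add, LinearMap.add_apply]
    exact dvd_add (hP hq) (hQ hq)
  | mul_X P i hP =>
    rw [map_mul, Module.End.mul_apply, recipOp_X]
    refine hP ?_
    obtain ⟨r, rfl⟩ := hq
    change _ ∣ recipDerivation σ i _
    rw [Derivation.leibniz, smul_eq_mul, smul_eq_mul]
    exact dvd_add (dvd_mul_right _ _) (dvd_mul_of_dvd_right (h0 i _) _)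

theorem exists_norm_aeval_le (q : MvPolynomial ι ℂ) (B : ℝ) :
    ∃ C : ℝ, 0 ≤ C ∧ ∀ T : ι → ℂ, (∀ k, ‖T k‖ ≤ B) → ‖MvPolynomial.aeval T q‖ ≤ C := by
  induction q using MvPolynomial.induction_on with
  | C a => exact ⟨‖a‖, norm_nonneg a, fun T _ => by simp⟩
  | add p q hp hq =>
    obtain ⟨C, hC, h⟩ := hp
    obtain ⟨C', hC', h'⟩ := hq
    refine ⟨C + C', add_nonneg hC hC', fun T hT => ?_⟩
    rw [map_add]
    exact (norm_add_le _ _).trans (add_le_add (h T hT) (h' T hT))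
  | mul_X p k hp =>
    obtain ⟨C, hC, h⟩ := hp
    refine ⟨C * |B|, by positivity, fun T hT => ?_⟩
    rw [map_mul, norm_mul, MvPolynomial.aeval_X]
    exact mul_le_mul (h T hT) ((hT k).trans (le_abs_self B)) (norm_nonneg _) hC

end Reciprocals

/-! ### The cocycle relation, equivariance and size of the rational cocycle -/

section Psi

variable {n : ℕ}

/-- The columns are drawn from a larger family so that all faces of an `(n+1)`-tuple can be compared
in one polynomial ring. -/
theorem polyDiff_ratFun_submatrix {ι : Type*} [Finite ι] (σ : Matrix (Fin n) ι ℂ)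
    (e : Fin n → ι) (P : MvPolynomial (Fin n) ℂ) {x : Fin n → ℂ} (hx : x ∈ nonvanishing σ) :
    polyDiff P (ratFun (σ.submatrix id e)) x = recipEval σ x (recipOp σ P
      (MvPolynomial.C (σ.submatrix id e).det * ∏ k, MvPolynomial.X (e k))) := by
  refine polyDiff_eqOn σ P (fun y _ => ?_) hx
  have hC (a : ℂ) : recipEval σ y (MvPolynomial.C a) = a := MvPolynomial.aeval_C ..
  simp only [map_mul, map_prod, recipEval_X, hC, Finset.prod_inv_distrib, ratFun, div_eq_mul_inv]
  rfl

theorem ratFunDiff_eq_zero_of_notMem {σ : Matrix (Fin n) (Fin n) ℂ} {x : Fin n → ℂ}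
    (P : MvPolynomial (Fin n) ℂ) (hx : x ∉ nonvanishing σ) : ratFunDiff σ P x = 0 := by
  rw [ratFunDiff, if_pos]
  simpa [nonvanishing] using hx

theorem ratFunDiff_of_mem {σ : Matrix (Fin n) (Fin n) ℂ} {x : Fin n → ℂ}
    (P : MvPolynomial (Fin n) ℂ) (hx : x ∈ nonvanishing σ) :
    ratFunDiff σ P x = polyDiff P (ratFun σ) x := by
  rw [ratFunDiff, if_neg]
  simpa [nonvanishing] using hx

theorem ratFunDiff_eq_recipEval {σ : Matrix (Fin n) (Fin n) ℂ} {x : Fin n → ℂ}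
    (P : MvPolynomial (Fin n) ℂ) (hx : x ∈ nonvanishing σ) :
    ratFunDiff σ P x = recipEval σ x (recipOp σ P
      (MvPolynomial.C σ.det * ∏ k, MvPolynomial.X k)) := by
  rw [ratFunDiff_of_mem P hx]
  exact polyDiff_ratFun_submatrix σ id P hx

/-- The alternating sum of the maximal minors of `v`, weighted by the columns, vanishes. -/
theorem sum_minors_mul_vecMul (v : Matrix (Fin n) (Fin (n + 1)) ℂ) (y : Fin n → ℂ) :
    ∑ j : Fin (n + 1), (-1 : ℂ) ^ (j : ℕ) * Matrix.vecMul y v j *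
      (v.submatrix id j.succAbove).det = 0 := by
  -- The added top row is a combination of the rows of `v`, so this determinant vanishes; expand it
  -- along that row.
  set A : Matrix (Fin (n + 1)) (Fin (n + 1)) ℂ :=
    Matrix.of (Fin.cons (Matrix.vecMul y v) fun i => v i) with hA
  have h0 : A.det = 0 := by
    refine Matrix.exists_vecMul_eq_zero_iff.1 ⟨Fin.cons (-1) y, fun e => ?_, ?_⟩
    · simpa using congrFun e 0
    · funext j
      simp [hA, Matrix.vecMul, dotProduct, Fin.sum_univ_succ]
  rw [Matrix.det_succ_row_zero] at h0
  exact h0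

/-- Before differentiation this is the identity of minors divided by the product of all `n + 1`
forms. It holds on an open set, so `P(-∂)` may be applied. -/
theorem sum_ratFunDiff_succAbove {v : Matrix (Fin n) (Fin (n + 1)) ℂ}
    (P : MvPolynomial (Fin n) ℂ) {x : Fin n → ℂ} (hx : x ∈ nonvanishing v) :
    ∑ j : Fin (n + 1), (-1 : ℂ) ^ (j : ℕ) *
      ratFunDiff (v.submatrix id j.succAbove) P x = 0 := by
  set Q : Fin (n + 1) → MvPolynomial (Fin (n + 1)) ℂ := fun j =>
    MvPolynomial.C (v.submatrix id j.succAbove).det * ∏ k, MvPolynomial.X (j.succAbove k) with hQ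
  have h1 (j : Fin (n + 1)) : ratFunDiff (v.submatrix id j.succAbove) P x =
      recipEval v x (recipOp v P (Q j)) := by
    rw [ratFunDiff_of_mem, polyDiff_ratFun_submatrix v _ P hx]
    exact fun k => hx (j.succAbove k)
  have h2 : Set.EqOn (fun _ => (0 : ℂ))
      (fun y => recipEval v y (∑ j : Fin (n + 1), (-1 : ℂ) ^ (j : ℕ) • Q j)) (nonvanishing v) := by
    intro y hy
    have hC (a : ℂ) : recipEval v y (MvPolynomial.C a) = a := MvPolynomial.aeval_C ..
    simp only [hQ, map_sum, map_smul, map_mul, map_prod, recipEval_X, hC, smul_eq_mul]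
    rw [← mul_zero (∏ k, (Matrix.vecMul y v k)⁻¹), ← sum_minors_mul_vecMul v y, Finset.mul_sum]
    refine Finset.sum_congr rfl fun j _ => ?_
    rw [Fin.prod_univ_succAbove _ j]
    have := hy j
    field_simp
  have h3 := (polyDiff_eqOn v P h2 hx).symm.trans
    (polyDiff_eqOn v P (q := 0) (fun y _ => (map_zero (recipEval v y)).symm) hx)
  simpa only [h1, map_sum, map_smul, smul_eq_mul, map_zero] using h3

theorem ratFunDiff_mul {A : Matrix (Fin n) (Fin n) ℂ} (hA : A.det = 1)
    {P : MvPolynomial (Fin n) ℂ}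
    (hP : MvPolynomial.aeval (fun i => ∑ j, MvPolynomial.C (A i j) * MvPolynomial.X j) P = P)
    (σ : Matrix (Fin n) (Fin n) ℂ) (x : Fin n → ℂ) :
    ratFunDiff (A * σ) P x = ratFunDiff σ P (Matrix.vecMul x A) := by
  have hmem : x ∈ nonvanishing (A * σ) ↔ Matrix.vecMul x A ∈ nonvanishing σ := by
    simp [nonvanishing, Matrix.vecMul_vecMul]
  by_cases hx : x ∈ nonvanishing (A * σ)
  · rw [ratFunDiff_eq_recipEval P hx, ratFunDiff_eq_recipEval P (hmem.1 hx), recipEval_mul,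
      recipOp_mul, AlgHom.comp_apply, hP, Matrix.det_mul, hA, one_mul]
  · rw [ratFunDiff_eq_zero_of_notMem P hx, ratFunDiff_eq_zero_of_notMem P (hmem.not.1 hx)]

/-- By divisibility, the value is any chosen reciprocal `1 / ⟨y, σ_k⟩` times a polynomial in
reciprocals of size at most `1 / c`. For invertible `σ` the largest form is at least a multiple of
`‖y‖`; for `det σ = 0` the value is zero. -/
theorem exists_norm_mul_norm_ratFunDiff_le (σ : Matrix (Fin n) (Fin n) ℂ)
    (P : MvPolynomial (Fin n) ℂ) {c : ℝ} (hc : 0 < c) :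
    ∃ C : ℝ, 0 ≤ C ∧ ∀ y : Fin n → ℂ,
      (∀ k, Matrix.vecMul y σ k ≠ 0 → c ≤ ‖Matrix.vecMul y σ k‖) →
        ‖y‖ * ‖ratFunDiff σ P y‖ ≤ C := by
  by_cases hdet : σ.det = 0
  · refine ⟨0, le_rfl, fun y _ => ?_⟩
    by_cases hy : y ∈ nonvanishing σ
    · simp [ratFunDiff_eq_recipEval P hy, hdet]
    · simp [ratFunDiff_eq_zero_of_notMem P hy]
  obtain ⟨r, hr⟩ := dvd_recipOp σ P
    (Dvd.intro_left (MvPolynomial.C σ.det) rfl :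
      ∏ k, MvPolynomial.X k ∣ MvPolynomial.C σ.det * ∏ k, MvPolynomial.X k)
  choose B hB0 hB using fun k => exists_norm_aeval_le
    ((∏ j ∈ Finset.univ.erase k, MvPolynomial.X j) * r) c⁻¹
  let S : (Fin n → ℂ) →L[ℂ] (Fin n → ℂ) := (Matrix.toLin' (σ⁻¹).transpose).toContinuousLinearMap
  have hS (y : Fin n → ℂ) : ‖y‖ ≤ ‖S‖ * ‖Matrix.vecMul y σ‖ := by
    have h : S (Matrix.vecMul y σ) = y := by
      simp [S, Matrix.mulVec_transpose, Matrix.vecMul_vecMul,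
        Matrix.mul_nonsing_inv σ (isUnit_iff_ne_zero.2 hdet)]
    conv_lhs => rw [← h]
    exact S.le_opNorm _
  refine ⟨‖S‖ * ∑ k, B k, mul_nonneg (norm_nonneg _) (Finset.sum_nonneg fun k _ => hB0 k),
    fun y hyc => ?_⟩
  by_cases hy : y ∈ nonvanishing σ
  swap
  · rw [ratFunDiff_eq_zero_of_notMem P hy, norm_zero, mul_zero]
    exact mul_nonneg (norm_nonneg _) (Finset.sum_nonneg fun k _ => hB0 k)
  have hT (k : Fin n) : ‖(Matrix.vecMul y σ k)⁻¹‖ ≤ c⁻¹ := by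
    rw [norm_inv]
    exact inv_anti₀ hc (hyc k (hy k))
  refine (mul_le_mul_of_nonneg_right (hS y) (norm_nonneg _)).trans ?_
  rw [mul_assoc]
  refine mul_le_mul_of_nonneg_left ?_ (norm_nonneg _)
  have hsum : 0 ≤ ∑ k, B k := Finset.sum_nonneg fun k _ => hB0 k
  rcases (norm_nonneg (ratFunDiff σ P y)).eq_or_lt with h0 | hpos
  · rw [← h0, mul_zero]
    exact hsum
  rw [← le_div_iff₀ hpos, pi_norm_le_iff_of_nonneg (div_nonneg hsum hpos.le)]
  intro k
  rw [le_div_iff₀ hpos]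
  refine le_trans ?_ (Finset.single_le_sum (fun k _ => hB0 k) (Finset.mem_univ k))
  rw [ratFunDiff_eq_recipEval P hy, hr, ← Finset.mul_prod_erase _ _ (Finset.mem_univ k), mul_assoc,
    map_mul, recipEval_X, ← norm_mul, ← mul_assoc, mul_inv_cancel₀ (hy k), one_mul]
  exact hB k _ hT

theorem vecMul_firstColumn_ne_zero (A : GL (Fin n) ℂ) {x : Fin n → ℂ} (hx : x ≠ 0) :
    Matrix.vecMul x A.val (firstColumn A hx) ≠ 0 := by
  classical
  have h := Finset.min'_mem _ (nonzero_columns_nonempty A hx)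
  exact (Finset.mem_filter.1 h).2

theorem psi_of_ne_zero (𝔄 : Fin n → GL (Fin n) ℂ) (P : MvPolynomial (Fin n) ℂ) {x : Fin n → ℂ}
    (hx : x ≠ 0) : psi 𝔄 P x =
      ratFunDiff (Matrix.of fun i k => (𝔄 k).val i (firstColumn (𝔄 k) hx)) P x :=
  dif_neg hx

theorem psi_zero (𝔄 : Fin n → GL (Fin n) ℂ) (P : MvPolynomial (Fin n) ℂ) : psi 𝔄 P 0 = 0 :=
  dif_pos rfl

/-- The selected column of each matrix depends only on that matrix and `x`, so all faces are
submatrices of a single matrix whose forms do not vanish at `x`. -/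
theorem isHomogeneousCocycle_psi {d : ℕ} (P : MvPolynomial (Fin (d + 1)) ℂ)
    (x : Fin (d + 1) → ℂ) :
    IsHomogeneousCocycle fun 𝔄 : Fin (d + 1) → GL (Fin (d + 1)) ℂ => psi 𝔄 P x := by
  intro t
  by_cases hx : x = 0
  · simp [hx, psi_zero]
  simp only [psi_of_ne_zero _ _ hx]
  exact sum_ratFunDiff_succAbove (v := Matrix.of fun i k => (t k).val i (firstColumn (t k) hx)) P
    fun k => vecMul_firstColumn_ne_zero (t k) hx

/-- Pairing `x` with a column of `A * B` is pairing `x A` with that column of `B`, so the same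
columns are selected on both sides. -/
theorem psi_mul {A : GL (Fin n) ℂ} (hA : A.val.det = 1) {P : MvPolynomial (Fin n) ℂ}
    (hP : MvPolynomial.aeval
      (fun i => ∑ j, MvPolynomial.C (A.val i j) * MvPolynomial.X j) P = P)
    (𝔄 : Fin n → GL (Fin n) ℂ) (x : Fin n → ℂ) :
    psi (fun k => A * 𝔄 k) P x = psi 𝔄 P (Matrix.vecMul x A.val) := by
  by_cases hx : x = 0
  · rw [hx, psi_zero, Matrix.zero_vecMul, psi_zero]
  have hx' : Matrix.vecMul x A.val ≠ 0 := by
    intro h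
    refine hx ?_
    have h1 : Matrix.vecMul (Matrix.vecMul x A.val) (A⁻¹).val = x := by
      rw [Matrix.vecMul_vecMul, ← Units.val_mul, mul_inv_cancel, Units.val_one, Matrix.vecMul_one]
    rw [← h1, h, Matrix.zero_vecMul]
  rw [psi_of_ne_zero _ _ hx, psi_of_ne_zero _ _ hx', ← ratFunDiff_mul hA hP]
  congr 1
  have hcol (k : Fin n) : firstColumn (A * 𝔄 k) hx = firstColumn (𝔄 k) hx' := by
    simp only [firstColumn, Units.val_mul, Matrix.vecMul_vecMul]
  ext i k
  simp only [Matrix.of_apply, hcol, Units.val_mul, Matrix.mul_apply]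

theorem exists_norm_mul_norm_psi_le (𝔄 : Fin n → GL (Fin n) ℂ) (P : MvPolynomial (Fin n) ℂ)
    {c : ℝ} (hc : 0 < c) :
    ∃ C : ℝ, 0 ≤ C ∧ ∀ y : Fin n → ℂ,
      (∀ k j, Matrix.vecMul y (𝔄 k).val j ≠ 0 → c ≤ ‖Matrix.vecMul y (𝔄 k).val j‖) →
        ‖y‖ * ‖psi 𝔄 P y‖ ≤ C := by
  -- The selected columns vary with `y`, but there are finitely many selections `J`; the bounds are
  -- added.
  choose B hB0 hB using fun J : Fin n → Fin n =>
    exists_norm_mul_norm_ratFunDiff_le (Matrix.of fun i k => (𝔄 k).val i (J k)) P hc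
  refine ⟨∑ J, B J, Finset.sum_nonneg fun J _ => hB0 J, fun y hy => ?_⟩
  by_cases hy0 : y = 0
  · rw [hy0, norm_zero, zero_mul]
    exact Finset.sum_nonneg fun J _ => hB0 J
  rw [psi_of_ne_zero _ _ hy0]
  exact (hB (fun k => firstColumn (𝔄 k) hy0) y fun k => hy k _).trans
    (Finset.single_le_sum (fun J _ => hB0 J) (Finset.mem_univ _))

end Psi

/-! ### The representation `ϱ`: determinant, invariance of the norm form, action on coordinates. -/

section UnitRep

variable {n : ℕ} {F K : Type*} [Field F] [CharZero F] [Algebra F ℂ] [Field K] [Algebra F K]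
variable (m : Module.Basis (Fin n) F K) (ρ : Fin n ≃ (K →ₐ[F] ℂ))

theorem unitRep_val (η : (𝓞 K)ˣ) : (unitRep m ρ η).val =
    (embGL m ρ).val * Matrix.diagonal (fun i => ρ i (algebraMap (𝓞 K) K η)) *
      (embGL m ρ)⁻¹.val :=
  rfl

theorem det_unitRep (η : (𝓞 K)ˣ) :
    (unitRep m ρ η).val.det = ∏ i, ρ i (algebraMap (𝓞 K) K η) := by
  rw [unitRep_val, Matrix.det_mul_right_comm, ← Units.val_mul, mul_inv_cancel, Units.val_one,
    one_mul, Matrix.det_diagonal]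

/-- The linear factors of the norm form are eigenvectors of the substitution, with eigenvalues `ρ i
η`, whose product is one. -/
theorem aeval_unitRep_normForm {η : (𝓞 K)ˣ} (hη : ∏ i, ρ i (algebraMap (𝓞 K) K η) = 1) :
    MvPolynomial.aeval (fun i => ∑ j,
      MvPolynomial.C ((unitRep m ρ η).val i j) * MvPolynomial.X j) (normForm m ρ) =
        normForm m ρ := by
  have h1 : (embGL m ρ)⁻¹.val * (unitRep m ρ η).val =
      Matrix.diagonal (fun i => ρ i (algebraMap (𝓞 K) K η)) * (embGL m ρ)⁻¹.val := by
    rw [unitRep_val, ← mul_assoc, ← mul_assoc, ← Units.val_mul, inv_mul_cancel, Units.val_one,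
      one_mul]
  have h2 (i k : Fin n) : ∑ j, (embGL m ρ)⁻¹.val i j * (unitRep m ρ η).val j k =
      ρ i (algebraMap (𝓞 K) K η) * (embGL m ρ)⁻¹.val i k := by
    rw [← Matrix.mul_apply, h1, Matrix.diagonal_mul]
  have h3 (i : Fin n) : MvPolynomial.aeval (fun i => ∑ j,
      MvPolynomial.C ((unitRep m ρ η).val i j) * MvPolynomial.X j)
        (∑ j, MvPolynomial.X j * MvPolynomial.C ((embGL m ρ)⁻¹.val.transpose j i)) =
      MvPolynomial.C (ρ i (algebraMap (𝓞 K) K η)) * ∑ j, (MvPolynomial.X j *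
        MvPolynomial.C ((embGL m ρ)⁻¹.val.transpose j i) : MvPolynomial (Fin n) ℂ) := by
    simp only [map_sum, map_mul, MvPolynomial.aeval_X, MvPolynomial.aeval_C,
      MvPolynomial.algebraMap_eq, Matrix.transpose_apply, Finset.sum_mul, Finset.mul_sum]
    rw [Finset.sum_comm]
    refine Finset.sum_congr rfl fun k _ => ?_
    rw [mul_left_comm, ← map_mul, ← h2, map_sum, Finset.mul_sum]
    refine Finset.sum_congr rfl fun j _ => ?_
    rw [map_mul]
    ring
  rw [normForm, map_prod]
  simp only [h3]
  rw [Finset.prod_mul_distrib, ← map_prod, hη, map_one, one_mul]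

/-- With `ξ = ∑ x i • m i`, the vector `x M` consists of the conjugates of `ξ`, so `ϱ(η)` acts as
multiplication of `ξ` by `η` in the basis `m`. -/
theorem vecMul_unitRep (η : (𝓞 K)ˣ) (x : Fin n → F) (j : Fin n) :
    Matrix.vecMul (fun i => algebraMap F ℂ (x i)) (unitRep m ρ η).val j =
      algebraMap F ℂ (m.repr ((∑ i, x i • m i) * algebraMap (𝓞 K) K η) j) := by
  set ξ : K := ∑ i, x i • m i with hξ
  have hM (y : Fin n → F) : Matrix.vecMul (fun i => algebraMap F ℂ (y i)) (embGL m ρ).val =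
      fun i => ρ i (∑ k, y k • m k) := by
    funext i
    simp [Matrix.vecMul, dotProduct, embGL, Matrix.GeneralLinearGroup.mkOfDetNeZero, embMatrix,
      Algebra.smul_def]
  have h1 : Matrix.vecMul (fun i => algebraMap F ℂ (m.repr (ξ * algebraMap (𝓞 K) K η) i))
      (embGL m ρ).val = fun i => ρ i ξ * ρ i (algebraMap (𝓞 K) K η) := by
    rw [hM, m.sum_repr]
    simp
  have h2 : Matrix.vecMul (fun i => algebraMap F ℂ (x i)) (unitRep m ρ η).val =
      fun j => algebraMap F ℂ (m.repr (ξ * algebraMap (𝓞 K) K η) j) := by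
    rw [unitRep_val, ← Matrix.vecMul_vecMul, ← Matrix.vecMul_vecMul, hM, ← hξ]
    have h3 : Matrix.vecMul (fun i => ρ i ξ)
        (Matrix.diagonal fun i => ρ i (algebraMap (𝓞 K) K η)) =
        fun i => ρ i ξ * ρ i (algebraMap (𝓞 K) K η) := by
      funext i
      rw [Matrix.vecMul_diagonal]
    rw [h3, ← h1, Matrix.vecMul_vecMul, ← Units.val_mul, mul_inv_cancel, Units.val_one,
      Matrix.vecMul_one]
  exact congrFun h2 j

end UnitRep

/-! ### Integers of imaginary quadratic fields -/

section ImaginaryQuadratic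

open NumberField

/-- There is a single infinite place, and a nonzero integer cannot be small at all infinite places.
-/
theorem one_le_norm_of_imaginary_quadratic {F : Type*} [Field F] [NumberField F]
    [IsTotallyComplex F] (hF : Module.finrank ℚ F = 2) (φ : F →+* ℂ) {a : 𝓞 F} (ha : a ≠ 0) :
    1 ≤ ‖φ a‖ := by
  have hcard : Fintype.card (InfinitePlace F) = 1 := by
    have h1 := IsTotallyComplex.finrank (K := F)
    have h2 := IsTotallyComplex.nrRealPlaces_eq_zero F
    rw [InfinitePlace.card_eq_nrRealPlaces_add_nrComplexPlaces]
    omega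
  have hsub : Subsingleton (InfinitePlace F) := (Fintype.card_le_one_iff_subsingleton).1 hcard.le
  have h := InfinitePlace.one_le_of_lt_one (w := InfinitePlace.mk φ) ha
    fun z hz => absurd (Subsingleton.elim _ _) hz
  rwa [InfinitePlace.apply] at h

theorem exists_common_denominator {F K ι : Type*} [Field F] [NumberField F] [Field K]
    [NumberField K] [Fintype ι] (f : ι → 𝓞 K →+ F) :
    ∃ b : 𝓞 F, b ≠ 0 ∧ ∀ i a, ∃ t : 𝓞 F, algebraMap (𝓞 F) F t = b * f i a := by
  classical
  obtain ⟨S, hS⟩ := (inferInstance : Module.Finite ℤ (𝓞 K)).fg_top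
  obtain ⟨b, hb⟩ := IsLocalization.exist_integer_multiples_of_finset (𝓞 F)⁰
    ((Finset.univ ×ˢ S).image fun p : ι × 𝓞 K => f p.1 p.2)
  refine ⟨b, nonZeroDivisors.ne_zero b.2, fun i a => ?_⟩
  have ha : a ∈ Submodule.span ℤ (S : Set (𝓞 K)) := hS ▸ Submodule.mem_top
  induction ha using Submodule.span_induction with
  | mem a ha =>
    obtain ⟨t, ht⟩ := hb (f i a) (Finset.mem_image_of_mem
      (fun p : ι × 𝓞 K => f p.1 p.2) (a := (i, a)) (by simpa using ha))
    exact ⟨t, ht.trans (Algebra.smul_def _ _)⟩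
  | zero => exact ⟨0, by simp⟩
  | add a a' _ _ h h' =>
    obtain ⟨t, ht⟩ := h
    obtain ⟨t', ht'⟩ := h'
    exact ⟨t + t', by rw [map_add, ht, ht', map_add, mul_add]⟩
  | smul k a _ h =>
    obtain ⟨t, ht⟩ := h
    exact ⟨k • t, by rw [map_zsmul, ht, map_zsmul, mul_smul_comm]⟩

/-- The additive group of `𝓞 K` is finitely generated, so the coordinates of all the products of `ξ`
with integers have a common denominator `b`; the nonzero ones have absolute value at least `1 /
|b|`. -/
theorem exists_le_norm_vecMul_unitRep {n : ℕ} {F K : Type*} [Field F] [NumberField F]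
    [IsTotallyComplex F] (hF : Module.finrank ℚ F = 2) [Algebra F ℂ] [Field K] [NumberField K]
    [Algebra F K] (m : Module.Basis (Fin n) F K) (ρ : Fin n ≃ (K →ₐ[F] ℂ)) (x : Fin n → F) :
    ∃ c : ℝ, 0 < c ∧ ∀ (η : (𝓞 K)ˣ) (j : Fin n),
      Matrix.vecMul (fun i => algebraMap F ℂ (x i)) (unitRep m ρ η).val j ≠ 0 →
        c ≤ ‖Matrix.vecMul (fun i => algebraMap F ℂ (x i)) (unitRep m ρ η).val j‖ := by
  obtain ⟨b, hb, h⟩ := exists_common_denominator (F := F) (K := K) (ι := Fin n) fun j =>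
    ((m.coord j).toAddMonoidHom.comp (AddMonoidHom.mulLeft (∑ i, x i • m i))).comp
      (algebraMap (𝓞 K) K).toAddMonoidHom
  have hbpos : 0 < ‖algebraMap F ℂ b‖ :=
    zero_lt_one.trans_le (one_le_norm_of_imaginary_quadratic hF _ hb)
  refine ⟨‖algebraMap F ℂ b‖⁻¹, inv_pos.2 hbpos, fun η j hne => ?_⟩
  obtain ⟨t, ht⟩ := h j η
  rw [vecMul_unitRep] at hne ⊢
  set z : F := m.repr ((∑ i, x i • m i) * algebraMap (𝓞 K) K η) j with hz
  change algebraMap (𝓞 F) F t = b * z at ht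
  have ht0 : t ≠ 0 := by
    rintro rfl
    rw [map_zero, eq_comm, mul_eq_zero] at ht
    rcases ht with h | h
    · exact hb (by exact_mod_cast h)
    · exact hne (by rw [h, map_zero])
  have h1 := one_le_norm_of_imaginary_quadratic hF (algebraMap F ℂ) ht0
  rw [show (t : F) = b * z from ht, map_mul, norm_mul] at h1
  rwa [inv_le_iff_one_le_mul₀' hbpos]

end ImaginaryQuadratic

/-! ### Growth of units and summability -/

section Growth

theorem summable_prod_pi {d : ℕ} {g : ℤ → ℝ} (h0 : ∀ k, 0 ≤ g k) (hg : Summable g) :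
    Summable fun k : Fin d → ℤ => ∏ j, g (k j) := by
  induction d with
  | zero => exact (hasSum_fintype _).summable
  | succ d ih =>
    rw [← (Fin.consEquiv fun _ : Fin (d + 1) => ℤ).summable_iff]
    refine (hg.mul_of_nonneg ih h0 fun k => Finset.prod_nonneg fun j _ => h0 _).congr fun p => ?_
    simp [Fin.consEquiv, Fin.prod_univ_succ]

theorem summable_exp_neg_sum_abs (d : ℕ) {c : ℝ} (hc : 0 < c) :
    Summable fun k : Fin d → ℤ => Real.exp (-(c * ∑ j, |(k j : ℝ)|)) := by
  have h1 : Summable fun k : ℕ => Real.exp (-c) ^ k :=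
    summable_geometric_of_lt_one (Real.exp_pos _).le (by simpa using hc)
  have h2 : Summable fun k : ℤ => Real.exp (-(c * |(k : ℝ)|)) := by
    refine Summable.of_nat_of_neg (h1.congr fun k => ?_) (h1.congr fun k => ?_) <;>
    · rw [← Real.exp_nat_mul]
      congr 1
      simp
      ring
  refine (summable_prod_pi (fun k => (Real.exp_pos _).le) h2).congr fun k => ?_
  rw [← Real.exp_sum, Finset.mul_sum, Finset.sum_neg_distrib]

/-- A negative entry is compensated by positive ones, one of which carries at least the share `1 /
n`. -/
theorem exists_abs_le_mul_of_sum_eq_zero {n : ℕ} {a : Fin n → ℝ} (ha : ∑ i, a i = 0) (i : Fin n) :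
    ∃ j, |a i| ≤ n * a j := by
  have hn : (1 : ℝ) ≤ n := by exact_mod_cast i.pos
  by_contra! h
  rcases le_total 0 (a i) with h0 | h0
  · have := h i
    rw [abs_of_nonneg h0] at this
    nlinarith
  · have h1 : ∑ j ∈ Finset.univ.erase i, (n : ℝ) * a j ≤
        ∑ j ∈ Finset.univ.erase i, |a i| := Finset.sum_le_sum fun j _ => (h j).le
    rw [← Finset.mul_sum, Finset.sum_const, Finset.card_erase_of_mem (Finset.mem_univ i),
      Finset.card_univ, Fintype.card_fin, nsmul_eq_mul, Nat.cast_pred i.pos] at h1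
    have h2 := Finset.add_sum_erase Finset.univ a (Finset.mem_univ i)
    rw [ha] at h2
    have h3 : ∑ j ∈ Finset.univ.erase i, a j = |a i| := by
      rw [abs_of_nonpos h0]
      linarith
    rw [h3] at h1
    have h4 : |a i| = 0 := le_antisymm (by nlinarith) (abs_nonneg _)
    have h5 := h i
    rw [abs_eq_zero.1 h4] at h5
    simp at h5

/-- Coordinates with respect to a basis are bounded by the logarithmic embedding. -/
theorem exists_sum_abs_repr_le {G : Type*} [CommGroup G] {d : ℕ}
    {L : Additive G →+ (Fin d → ℝ)} {w : Fin d → G} (hw : logDet L w ≠ 0)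
    (htop : Subgroup.closure (Set.range w) = ⊤) :
    ∃ C : ℝ, 0 < C ∧ ∀ g : Additive G,
      ∑ j, |(((basisOfLogDet hw htop).repr g j : ℤ) : ℝ)| ≤ C * ‖L g‖ := by
  set A : Matrix (Fin d) (Fin d) ℝ := Matrix.of fun i j => L (Additive.ofMul (w j)) i with hA
  let S : (Fin d → ℝ) →L[ℝ] (Fin d → ℝ) := (Matrix.toLin' A⁻¹).toContinuousLinearMap
  refine ⟨(d + 1) * (‖S‖ + 1), by positivity, fun g => ?_⟩
  set k : Fin d → ℝ := fun j => (((basisOfLogDet hw htop).repr g j : ℤ) : ℝ) with hk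
  have h1 : L g = A.mulVec k := by
    conv_lhs => rw [← (basisOfLogDet hw htop).sum_repr g]
    funext i
    rw [map_sum, Finset.sum_apply]
    refine Finset.sum_congr rfl fun j _ => ?_
    rw [map_zsmul, coe_basisOfLogDet]
    simp [hA, hk, mul_comm]
  have h2 : S (L g) = k := by
    simp [S, h1, Matrix.mulVec_mulVec, Matrix.nonsing_inv_mul A (isUnit_iff_ne_zero.2 hw)]
  have h3 : ‖k‖ ≤ ‖S‖ * ‖L g‖ := h2 ▸ S.le_opNorm _
  calc ∑ j, |k j| ≤ ∑ _j : Fin d, ‖k‖ := Finset.sum_le_sum fun j _ => norm_le_pi_norm k j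
    _ = d * ‖k‖ := by simp
    _ ≤ d * (‖S‖ * ‖L g‖) := by gcongr
    _ ≤ (d + 1) * (‖S‖ + 1) * ‖L g‖ := by
      rw [mul_assoc]
      gcongr <;> linarith

end Growth

/-! ### Exponential growth of units of relative norm one. -/

section UnitSums

variable {d : ℕ} {F K : Type*} [Field F] [Algebra F ℂ] [Field K] [Algebra F K]

/-- The truncated logarithmic embedding of units. -/
def unitLog (ρ : Fin (d + 1) ≃ (K →ₐ[F] ℂ)) (V : Subgroup (𝓞 K)ˣ) :
    Additive V →+ (Fin d → ℝ) where
  toFun η i := 2 * Real.log ‖ρ i.castSucc (algebraMap (𝓞 K) K (η.toMul : (𝓞 K)ˣ))‖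
  map_zero' := by
    funext i
    simp
  map_add' a b := by
    funext i
    have h (η : (𝓞 K)ˣ) : ‖ρ i.castSucc (algebraMap (𝓞 K) K η)‖ ≠ 0 := by simp
    simp only [toMul_add, Subgroup.coe_mul, Units.val_mul, map_mul, norm_mul, Pi.add_apply]
    rw [Real.log_mul (h _) (h _), mul_add]

theorem exists_le_norm_unit (ρ : Fin (d + 1) ≃ (K →ₐ[F] ℂ)) {V : Subgroup (𝓞 K)ˣ}
    (hV : ∀ η ∈ V, ∏ i, ρ i (algebraMap (𝓞 K) K η) = 1) {w : Fin d → V}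
    (hw : logDet (unitLog ρ V) w ≠ 0) (htop : Subgroup.closure (Set.range w) = ⊤) :
    ∃ c : ℝ, 0 < c ∧ ∀ η : V, ∃ i, Real.exp (c *
      ∑ j, |(((basisOfLogDet hw htop).repr (Additive.ofMul η) j : ℤ) : ℝ)|) ≤
        ‖ρ i (algebraMap (𝓞 K) K (η : (𝓞 K)ˣ))‖ := by
  obtain ⟨C, hC, h⟩ := exists_sum_abs_repr_le hw htop
  -- `C` compares coordinates with logarithms, `2` is the normalization of `unitLog`, and `d + 1` is
  -- the loss in passing to a positive logarithm.
  refine ⟨(C * 2 * (d + 1 : ℕ))⁻¹, by positivity, fun η => ?_⟩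
  set a : Fin (d + 1) → ℝ := fun i => Real.log ‖ρ i (algebraMap (𝓞 K) K (η : (𝓞 K)ˣ))‖ with ha
  have hne (i : Fin (d + 1)) : ‖ρ i (algebraMap (𝓞 K) K (η : (𝓞 K)ˣ))‖ ≠ 0 := by simp
  have hsum : ∑ i, a i = 0 := by
    rw [ha, ← Real.log_prod fun i _ => hne i, ← norm_prod, hV η η.2, norm_one, Real.log_one]
  obtain ⟨i, hi⟩ : ∃ i, ‖unitLog ρ V (Additive.ofMul η)‖ ≤ 2 * |a i| := by
    by_cases hd : Nonempty (Fin d)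
    · obtain ⟨i, hi⟩ := Finite.exists_max fun i => ‖unitLog ρ V (Additive.ofMul η) i‖
      refine ⟨i.castSucc, (pi_norm_le_iff_of_nonneg (by positivity)).2 fun j => (hi j).trans ?_⟩
      have : unitLog ρ V (Additive.ofMul η) i = 2 * a i.castSucc := rfl
      rw [this, norm_mul, Real.norm_eq_abs (a _)]
      simp
    · refine ⟨0, (pi_norm_le_iff_of_nonneg (by positivity)).2 fun j => absurd ⟨j⟩ hd⟩
  obtain ⟨j, hj⟩ := exists_abs_le_mul_of_sum_eq_zero hsum i
  refine ⟨j, ?_⟩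
  rw [← Real.exp_log (lt_of_le_of_ne (norm_nonneg _) (hne j).symm), Real.exp_le_exp,
    inv_mul_le_iff₀ (by positivity)]
  calc _ ≤ C * ‖unitLog ρ V (Additive.ofMul η)‖ := h _
    _ ≤ C * (2 * ((d + 1 : ℕ) * a j)) := by gcongr; exact hi.trans (by gcongr)
    _ = _ := by rw [ha]; ring

/-- Applying `M` to `x ϱ(η)` gives the vector of all `ρ i ξ * ρ i η`, and no `ρ i ξ` vanishes. -/
theorem exists_mul_norm_le_norm_vecMul [CharZero F] {n : ℕ} (m : Module.Basis (Fin n) F K)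
    (ρ : Fin n ≃ (K →ₐ[F] ℂ)) {x : Fin n → F} (hx : x ≠ 0) :
    ∃ C : ℝ, 0 < C ∧ ∀ (η : (𝓞 K)ˣ) (i : Fin n), ‖ρ i (algebraMap (𝓞 K) K η)‖ ≤
      C * ‖Matrix.vecMul (fun i => algebraMap F ℂ (x i)) (unitRep m ρ η).val‖ := by
  set X : Fin n → ℂ := fun i => algebraMap F ℂ (x i) with hX
  set ξ : K := ∑ i, x i • m i with hξ
  have hξ0 : ξ ≠ 0 := by
    intro h
    refine hx (funext fun i => ?_)
    rw [← m.repr_sum_self x, ← hξ, h]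
    simp
  let S : (Fin n → ℂ) →L[ℂ] (Fin n → ℂ) :=
    (Matrix.toLin' (embGL m ρ).val.transpose).toContinuousLinearMap
  have hS (y : Fin n → ℂ) : S y = Matrix.vecMul y (embGL m ρ).val := by
    simp [S, Matrix.mulVec_transpose]
  have hM : Matrix.vecMul X (embGL m ρ).val = fun i => ρ i ξ := by
    funext i
    simp [X, hξ, Matrix.vecMul, dotProduct, embGL, Matrix.GeneralLinearGroup.mkOfDetNeZero,
      embMatrix, Algebra.smul_def]
  have hpos (i : Fin n) : 0 < ‖ρ i ξ‖ := norm_pos_iff.2 (by simpa using hξ0)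
  have hsum : 0 ≤ ∑ i, ‖ρ i ξ‖⁻¹ := Finset.sum_nonneg fun i _ => (inv_pos.2 (hpos i)).le
  refine ⟨(∑ i, ‖ρ i ξ‖⁻¹ + 1) * (‖S‖ + 1), by positivity, fun η i => ?_⟩
  have h1 : ‖ρ i ξ‖ * ‖ρ i (algebraMap (𝓞 K) K η)‖ ≤
      ‖S‖ * ‖Matrix.vecMul X (unitRep m ρ η).val‖ := by
    have h2 : S (Matrix.vecMul X (unitRep m ρ η).val) i =
        ρ i ξ * ρ i (algebraMap (𝓞 K) K η) := by
      rw [hS, Matrix.vecMul_vecMul, unitRep_val, mul_assoc, ← Units.val_mul, inv_mul_cancel,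
        Units.val_one, mul_one, ← Matrix.vecMul_vecMul, hM, Matrix.vecMul_diagonal]
    rw [← norm_mul, ← h2]
    exact (norm_le_pi_norm _ i).trans (S.le_opNorm _)
  calc ‖ρ i (algebraMap (𝓞 K) K η)‖
      = ‖ρ i ξ‖⁻¹ * (‖ρ i ξ‖ * ‖ρ i (algebraMap (𝓞 K) K η)‖) := by
        rw [inv_mul_cancel_left₀ (hpos i).ne']
    _ ≤ (∑ i, ‖ρ i ξ‖⁻¹ + 1) *
        ((‖S‖ + 1) * ‖Matrix.vecMul X (unitRep m ρ η).val‖) := by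
        refine mul_le_mul ?_ (h1.trans ?_) (by positivity) (by positivity)
        · have := Finset.single_le_sum (f := fun i => ‖ρ i ξ‖⁻¹)
            (fun i _ => (inv_pos.2 (hpos i)).le) (Finset.mem_univ i)
          linarith
        · gcongr
          linarith
    _ = _ := by ring

theorem unitRep_injective [CharZero F] (m : Module.Basis (Fin (d + 1)) F K)
    (ρ : Fin (d + 1) ≃ (K →ₐ[F] ℂ)) : Function.Injective (unitRep m ρ) := by
  intro η η' h
  have h1 : diagUnits ρ η = diagUnits ρ η' := (MulAut.conj (embGL m ρ)).injective h
  have h2 : ρ 0 (algebraMap (𝓞 K) K η) = ρ 0 (algebraMap (𝓞 K) K η') := by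
    have := congrArg (fun A : GL (Fin (d + 1)) ℂ => A.val 0 0) h1
    simpa [diagUnits] using this
  exact Units.ext (FaithfulSMul.algebraMap_injective (𝓞 K) K ((ρ 0).injective h2))

end UnitSums

/-! ### The sums over groups of units -/

section CycleSums

variable {d : ℕ} {F K : Type*} [Field F] [CharZero F] [Algebra F ℂ] [Field K] [Algebra F K]

/-- The values of `ψ` on tuples of units. -/
def unitCochain (m : Module.Basis (Fin (d + 1)) F K) (ρ : Fin (d + 1) ≃ (K →ₐ[F] ℂ)) (l : ℕ)
    (x : Fin (d + 1) → F) (V : Subgroup (𝓞 K)ˣ) (t : Fin (d + 1) → V) : ℂ :=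
  psi (fun k => unitRep m ρ (t k)) (normForm m ρ ^ (l - 1)) fun i => algebraMap F ℂ (x i)

theorem isHomogeneousCocycle_unitCochain (m : Module.Basis (Fin (d + 1)) F K)
    (ρ : Fin (d + 1) ≃ (K →ₐ[F] ℂ)) (l : ℕ) (x : Fin (d + 1) → F) (V : Subgroup (𝓞 K)ˣ) :
    IsHomogeneousCocycle (unitCochain m ρ l x V) :=
  fun t => isHomogeneousCocycle_psi _ _ fun k => unitRep m ρ (t k)

theorem summable_unitCochain [NumberField F] [NumberField.IsTotallyComplex F] [NumberField K]
    (hF : Module.finrank ℚ F = 2) (m : Module.Basis (Fin (d + 1)) F K)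
    (ρ : Fin (d + 1) ≃ (K →ₐ[F] ℂ)) (l : ℕ) (x : Fin (d + 1) → F) {V : Subgroup (𝓞 K)ˣ}
    (hV : ∀ η ∈ V, ∏ i, ρ i (algebraMap (𝓞 K) K η) = 1) {w : Fin d → V}
    (htop : Subgroup.closure (Set.range w) = ⊤) (hw : logDet (unitLog ρ V) w ≠ 0)
    (t : Fin (d + 1) → V) : Summable fun g : V => unitCochain m ρ l x V fun k => g * t k := by
  by_cases hx : x = 0
  · have h0 : (fun i => algebraMap F ℂ (x i)) = 0 := by
      funext i
      simp [hx]
    simp only [unitCochain, h0, psi_zero]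
    exact summable_zero
  set X : Fin (d + 1) → ℂ := fun i => algebraMap F ℂ (x i) with hX
  obtain ⟨c, hc, hlow⟩ := exists_le_norm_vecMul_unitRep hF m ρ x
  obtain ⟨C, hC, hgrow⟩ := exists_mul_norm_le_norm_vecMul m ρ hx
  obtain ⟨κ, hκ, hexp⟩ := exists_le_norm_unit ρ hV hw htop
  obtain ⟨B, hB, hbound⟩ := exists_norm_mul_norm_psi_le (fun k => unitRep m ρ (t k))
    (normForm m ρ ^ (l - 1)) hc
  have hsum := ((summable_exp_neg_sum_abs d hκ).comp_injective
    ((basisOfLogDet hw htop).equivFun.toEquiv.injective.comp Additive.ofMul.injective)).mul_left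
      (C * B)
  refine Summable.of_norm_bounded hsum fun g => ?_
  have hg := hV g g.2
  have hpsi : unitCochain m ρ l x V (fun k => g * t k) = psi (fun k => unitRep m ρ (t k))
      (normForm m ρ ^ (l - 1)) (Matrix.vecMul X (unitRep m ρ g).val) := by
    rw [← psi_mul (by rw [det_unitRep, hg]) (by rw [map_pow, aeval_unitRep_normForm m ρ hg])]
    simp only [unitCochain, Subgroup.coe_mul, map_mul]
    rfl
  -- The forms at `x ϱ(g)` given by the columns of `ϱ(t k)` are the coordinates of `x ϱ(g t_k)`, so
  -- the lower bound `c`, valid for all units, applies.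
  have hb := hbound (Matrix.vecMul X (unitRep m ρ g).val) fun k j => by
    rw [Matrix.vecMul_vecMul, ← Units.val_mul, ← map_mul]
    exact hlow _ j
  obtain ⟨i, hi⟩ := hexp g
  have h1 := hi.trans (hgrow g i)
  rw [hpsi]
  set N := ‖psi (fun k => unitRep m ρ (t k)) (normForm m ρ ^ (l - 1))
    (Matrix.vecMul X (unitRep m ρ g).val)‖ with hN
  change N ≤ C * B * Real.exp (-(κ * ∑ j,
    |(((basisOfLogDet hw htop).repr (Additive.ofMul g) j : ℤ) : ℝ)|))
  rw [Real.exp_neg, ← div_eq_mul_inv, le_div_iff₀ (Real.exp_pos _)]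
  calc N * _ ≤ N * (C * ‖Matrix.vecMul X (unitRep m ρ g).val‖) :=
        mul_le_mul_of_nonneg_left h1 (norm_nonneg _)
    _ = C * (‖Matrix.vecMul X (unitRep m ρ g).val‖ * N) := by ring
    _ ≤ C * B := mul_le_mul_of_nonneg_left hb hC.le

theorem map_partialProd {G H : Type*} [Monoid G] [Monoid H] (f : G →* H) {k : ℕ} (w : Fin k → G)
    (j : Fin (k + 1)) : f (Fin.partialProd w j) = Fin.partialProd (f ∘ w) j := by
  induction j using Fin.induction with
  | zero => simp
  | succ j ih => simp [Fin.partialProd_succ, ih]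

theorem cycleTerm_unitRep (m : Module.Basis (Fin (d + 1)) F K)
    (ρ : Fin (d + 1) ≃ (K →ₐ[F] ℂ)) (l : ℕ) (x : Fin (d + 1) → F) {V : Subgroup (𝓞 K)ˣ}
    (w : Fin d → V) (η : V) :
    cycleTerm m ρ (fun i => (w i : (𝓞 K)ˣ)) l x (unitRep m ρ η) =
      (-1) ^ d * ((SignType.sign (logDet (unitLog ρ V) w) : ℤ) : ℂ) *
        ∑ π : Equiv.Perm (Fin d), sgn π *
          unitCochain m ρ l x V fun k => η * Fin.partialProd (w ∘ π) k := by
  set s : ℤ := (-1) ^ d * (SignType.sign (logDet (unitLog ρ V) w) : ℤ) with hs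
  have hbar (π : Equiv.Perm (Fin d)) (k : Fin (d + 1)) :
      unitRep m ρ η * bar (n := d + 1) (fun i => unitRep m ρ (w (π i))) k =
        unitRep m ρ ((η * Fin.partialProd (w ∘ π) k : V) : (𝓞 K)ˣ) := by
    rw [Subgroup.coe_mul, map_mul]
    congr 1
    exact (map_partialProd ((unitRep m ρ).comp V.subtype) (w ∘ π) k).symm
  -- By definition, `regulator` is `logDet` of the truncated logarithmic embedding.
  have hcyc : cycle m ρ (fun i => (w i : (𝓞 K)ˣ)) = s • ∑ π : Equiv.Perm (Fin d),
      Finsupp.single (bar (n := d + 1) fun i => unitRep m ρ (w (π i)))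
        ((Equiv.Perm.sign π : ℤˣ) : ℤ) := rfl
  rw [cycleTerm, psiChain, Chain.translate, hcyc, Finsupp.sum_mapDomain_index (by simp)
    (by intros; push_cast; ring), Finsupp.sum_smul_index (by simp),
    ← Finsupp.sum_finsetSum_index (by simp) (by intros; push_cast; ring), Finset.mul_sum]
  refine Finset.sum_congr rfl fun π _ => ?_
  rw [Finsupp.sum_single_index (by simp)]
  simp only [hbar, unitCochain, hs]
  push_cast
  ring

/-- The sum over a subgroup `U` of the terms of the cycle of `w`, as a signed alternating sum. -/
theorem hasSum_cycleTerm (m : Module.Basis (Fin (d + 1)) F K)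
    (ρ : Fin (d + 1) ≃ (K →ₐ[F] ℂ)) (l : ℕ) (x : Fin (d + 1) → F) {U V : Subgroup (𝓞 K)ˣ}
    (hUV : U ≤ V) (w : Fin d → V) (hs : logDet (unitLog ρ V) w ≠ 0 → ∀ t : Fin (d + 1) → V,
      Summable fun g : V => unitCochain m ρ l x V fun k => g * t k) :
    HasSum (fun A : U.map (unitRep m ρ) => cycleTerm m ρ (fun i => (w i : (𝓞 K)ˣ)) l x A)
      ((-1) ^ d * (((SignType.sign (logDet (unitLog ρ V) w) : ℤ) : ℂ) *
        altSum (orbitSum (U.subgroupOf V) (unitCochain m ρ l x V)) w)) := by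
  let e : U.subgroupOf V ≃ U.map (unitRep m ρ) :=
    (Subgroup.subgroupOfEquivOfLe hUV).toEquiv.trans
      (U.equivMapOfInjective _ (unitRep_injective m ρ)).toEquiv
  have he (h : U.subgroupOf V) : (e h : GL (Fin (d + 1)) ℂ) = unitRep m ρ (h : V) := rfl
  rw [← e.hasSum_iff]
  simp only [Function.comp_def, he, cycleTerm_unitRep, ← mul_assoc]
  -- A vanishing regulator makes every term zero, so summability of the cochain is not needed.
  by_cases h0 : logDet (unitLog ρ V) w = 0
  · simp only [h0, sign_zero, SignType.coe_zero, Int.cast_zero, mul_zero, zero_mul]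
    exact hasSum_zero
  refine HasSum.mul_left _ (hasSum_sum fun π _ => HasSum.mul_left _ ?_)
  exact ((hs h0 _).comp_injective Subtype.val_injective).hasSum

theorem exists_lift_generators {V U : Subgroup (𝓞 K)ˣ} (hUV : U ≤ V) {ε : Fin d → (𝓞 K)ˣ}
    (hε : Subgroup.closure (Set.range ε) = U) :
    ∃ w : Fin d → V, (ε = fun i => (w i : (𝓞 K)ˣ)) ∧
      Subgroup.closure (Set.range w) = U.subgroupOf V := by
  have hmem (i : Fin d) : ε i ∈ V := hUV (hε ▸ Subgroup.subset_closure ⟨i, rfl⟩)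
  refine ⟨fun i => ⟨ε i, hmem i⟩, rfl, Subgroup.map_injective V.subtype_injective ?_⟩
  rw [MonoidHom.map_closure, Subgroup.subgroupOf_map_subtype, inf_eq_left.2 hUV, ← hε,
    ← Set.range_comp]
  rfl

theorem prod_embeddings_eq_one {m : Module.Basis (Fin (d + 1)) F K}
    (ρ : Fin (d + 1) ≃ (K →ₐ[F] ℂ)) {𝔣 : Ideal (𝓞 K)} {V : Subgroup (𝓞 K)ˣ}
    (hV : IsFreePart F 𝔣 V) {η : (𝓞 K)ˣ} (hη : η ∈ V) :
    ∏ i, ρ i (algebraMap (𝓞 K) K η) = 1 := by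
  have : Module.Finite F K := Module.Finite.of_basis m
  have h1 : η ∈ unitsCongrOneNormOne F 𝔣 := hV.sup_torsion ▸ Subgroup.mem_sup_left hη
  have h2 : Algebra.norm F (algebraMap (𝓞 K) K η) = 1 :=
    congrArg Units.val (MonoidHom.mem_ker.1 (Subgroup.mem_inf.1 h1).2)
  rw [ρ.prod_comp fun φ => φ (algebraMap (𝓞 K) K η), ← Algebra.norm_eq_prod_embeddings F ℂ, h2,
    map_one]

/-- The sums attached to generators of `V` and of a subgroup `U` of finite index converge and
agree. -/
theorem summable_cycleTerm_and_tsum_eq [NumberField F] [NumberField.IsTotallyComplex F]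
    [NumberField K] (hF : Module.finrank ℚ F = 2) (m : Module.Basis (Fin (d + 1)) F K)
    (ρ : Fin (d + 1) ≃ (K →ₐ[F] ℂ)) {𝔣 : Ideal (𝓞 K)} (l : ℕ) (x : Fin (d + 1) → F)
    {U V : Subgroup (𝓞 K)ˣ} (hV : IsFreePart F 𝔣 V) (hUV : U ≤ V)
    (hfin : (U.subgroupOf V).FiniteIndex) {ε ε' : Fin d → (𝓞 K)ˣ}
    (hε : Subgroup.closure (Set.range ε) = V) (hε' : Subgroup.closure (Set.range ε') = U) :
    Summable (fun A : V.map (unitRep m ρ) => cycleTerm m ρ ε l x A) ∧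
      Summable (fun A : U.map (unitRep m ρ) => cycleTerm m ρ ε' l x A) ∧
      ∑' A : V.map (unitRep m ρ), cycleTerm m ρ ε l x A =
        ∑' A : U.map (unitRep m ρ), cycleTerm m ρ ε' l x A := by
  obtain ⟨w, rfl, hw⟩ := exists_lift_generators le_rfl hε
  obtain ⟨w', rfl, hw'⟩ := exists_lift_generators hUV hε'
  rw [Subgroup.subgroupOf_self] at hw
  have hs (h : logDet (unitLog ρ V) w ≠ 0) :=
    summable_unitCochain hF m ρ l x (fun η => prod_embeddings_eq_one (m := m) ρ hV) hw h
  have hs' (h : logDet (unitLog ρ V) w' ≠ 0) := hs <|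
    logDet_ne_zero_of_pow_mem (fun j => ⟨1, one_ne_zero, by simp [hw]⟩) h
  have h1 := hasSum_cycleTerm m ρ l x le_rfl w hs
  have h2 := hasSum_cycleTerm m ρ l x hUV w' hs'
  refine ⟨h1.summable, h2.summable, ?_⟩
  refine h1.tsum_eq.trans (Eq.trans ?_ h2.tsum_eq.symm)
  rw [Subgroup.subgroupOf_self, sign_mul_altSum_orbitSum (unitLog ρ V)
    (isHomogeneousCocycle_unitCochain m ρ l x V) _ hs hw hw']

end CycleSums

end EisensteinCocycle

end

theorem mainTheorem6 {n : ℕ} {F K : Type*}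
    -- `F` is an imaginary quadratic field with a fixed embedding into `ℂ`, and `K / F` is finite.
    [Field F] [NumberField F] [NumberField.IsTotallyComplex F] (hF : Module.finrank ℚ F = 2)
    [Algebra F ℂ] [Field K] [NumberField K] [Algebra F K]
    (ρ : Fin n ≃ (K →ₐ[F] ℂ))
    -- The ideals `𝔣`, `𝔟`, the element `r ∈ 𝔟⁻¹`, and the basis with `𝔣𝔟⁻¹ = Λ₁m₁ + ⋯ + Λₙmₙ`.
    (𝔣 𝔟 : Ideal (𝓞 K)) (h𝔣 : 𝔣 ≠ ⊥) (h𝔟 : 𝔟 ≠ ⊥) (hcop : IsCoprime 𝔣 𝔟)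
    (r : K) (hr : r ∈ (𝔟 : FractionalIdeal (𝓞 K)⁰ K)⁻¹)
    (m : Module.Basis (Fin n) F K) (Λ : Fin n → FractionalIdeal (𝓞 F)⁰ F)
    (hΛ : ∀ a : K, a ∈ (𝔣 : FractionalIdeal (𝓞 K)⁰ K) * (𝔟 : FractionalIdeal (𝓞 K)⁰ K)⁻¹ ↔
      ∃ c : Fin n → F, (∀ i, c i ∈ Λ i) ∧ a = ∑ i, c i • m i)
    (u : Fin n → F) (hu : r = ∑ i, u i • m i)
    -- The free part `V_𝔣` of the group of units `≡ 1 mod 𝔣` of relative norm `1`.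
    (V𝔣 : Subgroup (𝓞 K)ˣ) (hV𝔣 : EisensteinCocycle.IsFreePart F 𝔣 V𝔣)
    (l : ℕ) (hl : 0 < l) (x : Fin n → F) (hx : ∀ i, x i - u i ∈ Λ i) :
    (∀ ε ε' : Fin (n - 1) → (𝓞 K)ˣ,
      Subgroup.closure (Set.range ε) = V𝔣 → Subgroup.closure (Set.range ε') = V𝔣 →
        Summable (fun A : V𝔣.map (EisensteinCocycle.unitRep m ρ) =>
          EisensteinCocycle.cycleTerm m ρ ε l x A) ∧
        Summable (fun A : V𝔣.map (EisensteinCocycle.unitRep m ρ) =>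
          EisensteinCocycle.cycleTerm m ρ ε' l x A) ∧
        ∑' A : V𝔣.map (EisensteinCocycle.unitRep m ρ),
            EisensteinCocycle.cycleTerm m ρ ε l x A =
          ∑' A : V𝔣.map (EisensteinCocycle.unitRep m ρ),
            EisensteinCocycle.cycleTerm m ρ ε' l x A) ∧
    (∀ V : Subgroup (𝓞 K)ˣ, V ≤ V𝔣 → (V.subgroupOf V𝔣).FiniteIndex →
      ∀ ε ε' : Fin (n - 1) → (𝓞 K)ˣ,
        Subgroup.closure (Set.range ε) = V𝔣 → Subgroup.closure (Set.range ε') = V →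
          Summable (fun A : V𝔣.map (EisensteinCocycle.unitRep m ρ) =>
            EisensteinCocycle.cycleTerm m ρ ε l x A) ∧
          Summable (fun A : V.map (EisensteinCocycle.unitRep m ρ) =>
            EisensteinCocycle.cycleTerm m ρ ε' l x A) ∧
          ∑' A : V𝔣.map (EisensteinCocycle.unitRep m ρ),
              EisensteinCocycle.cycleTerm m ρ ε l x A =
            ∑' A : V.map (EisensteinCocycle.unitRep m ρ),
              EisensteinCocycle.cycleTerm m ρ ε' l x A) := by
  obtain _ | d := n
  -- The nonzero space `K` has no empty basis, so `n = d + 1`.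
  · exact (not_nonempty_iff.2 inferInstance m.index_nonempty).elim
  refine ⟨fun ε ε' hε hε' => ?_, fun V hV hfin ε ε' hε hε' =>
    EisensteinCocycle.summable_cycleTerm_and_tsum_eq hF m ρ l x hV𝔣 hV hfin hε hε'⟩
  -- Independence of the generators is the comparison with the subgroup `V𝔣` itself, of index one.
  refine EisensteinCocycle.summable_cycleTerm_and_tsum_eq hF m ρ l x hV𝔣 le_rfl ?_ hε hε'
  rw [Subgroup.subgroupOf_self]
  infer_instance
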